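/- Let $d\ge 1$, let $W\subseteq\mathbb{R}^d$ be convex and compact, and for each $t>0$ let $\eta_t=\sum_{i=1}^{N_t}\delta_{X_{t,i}}$ be a homogeneous Poisson point process of intensity $t$ supported in $W$ (i.e. all points lie in $W$, for Borel $A\subseteq\mathbb{R}^d$ the number $\eta_t(A)$ is Poisson distributed with mean $t\,\mathrm{vol}(A\cap W)$, and the numbers of points in pairwise disjoint Borel sets are independent), all defined on one probability space; nothing is assumed about the joint distribution of the processes for different $t$. Let $\delta_t>0$ with $\delta_t\to 0$ as $t\to\infty$. The random geometric graph $\mathcal G(\eta_t,\delta_t)$ has the points of $\eta_t$ as vertices and an edge between distinct points $x,y$ iff $\|x-y\|\le\delta_t$ (Euclidean norm). For $\tau\in\mathbb{R}$ put $$L_t^{(\tau)}=\frac12\sum_{(x,y)\in\eta_t^2,\;x\ne y}\mathbf 1(\|x-y\|\le\delta_t)\,\|x-y\|^{\tau},\qquad \tilde L_t^{(\tau)}=\frac{L_t^{(\tau)}-\mathbb{E}L_t^{(\tau)}}{\max\{t\,\delta_t^{\tau+d/2},\;t^{3/2}\delta_t^{\tau+d}\}},$$ where the sum is over ordered pairs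 of distinct points of the point set $\eta_t$; in particular $L_t^{(0)}$ is the number of edges. Assume the supercritical regime $t\delta_t^d\to\infty$ as $t\to\infty$. Then: 1. for all $\tau>-d/2$ and $t>0$, $L_t^{(\tau)}$ is integrable (so $\tilde L_t^{(\tau)}$ is well defined); 2. for all $\tau_1,\tau_2>-d/2$, with $a_i=\tau_i+d$, $$a_1\tilde L_t^{(\tau_1)}-a_2\tilde L_t^{(\tau_2)}\to 0\quad\text{in probability as }t\to\infty;$$ 3. hence the number of edges asymptotically determines every length power functional: for all $\tau>-d/2$, $$\tilde L_t^{(\tau)}-\frac{d}{\tau+d}\,\tilde L_t^{(0)}\to 0\quad\text{in probability as }t\to\infty.$$ -/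

import Mathlib

open MeasureTheory ProbabilityTheory Filter Topology

namespace RandomGeometricGraph

section Deterministic

variable {E : Type*} [NormedAddCommGroup E]

/-- The geometric graph on the finite point set `S`: two different points are joined by an edge
if and only if their distance is at most `δ`. -/
def geometricGraph (S : Finset E) (δ : ℝ) : SimpleGraph {x : E // x ∈ S} where
  Adj x y := x ≠ y ∧ ‖(x : E) - (y : E)‖ ≤ δ
  symm := ⟨fun x y h => ⟨h.1.symm, by rw [norm_sub_rev]; exact h.2⟩⟩
  loopless := ⟨fun _ h => h.1 rfl⟩

open Classical in
/-- The length power functional of the geometric graph of a finite point set `S` at distance `δ`: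
half the sum, over all ordered pairs of distinct points of `S` at distance at most `δ`, of the
`τ`-th power of the distance. -/
noncomputable def lengthPower (S : Finset E) (δ τ : ℝ) : ℝ :=
  (1 / 2 : ℝ) * ∑ p ∈ S.offDiag, if ‖p.1 - p.2‖ ≤ δ then ‖p.1 - p.2‖ ^ τ else 0

end Deterministic

/-- A finite point process on `E`: a random number `N` of points and random points
`X 0, …, X (N - 1)` (the values `X i ω` with `i ≥ N ω` carry no meaning). It stands for the
random counting measure `∑ i < N ω, δ_{X i ω}`. -/
structure PointProcess (Ω E : Type*) [MeasurableSpace Ω] [MeasurableSpace E] where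
  N : Ω → ℕ
  X : ℕ → Ω → E
  measurable_N : Measurable N
  measurable_X : ∀ i, Measurable (X i)

namespace PointProcess

variable {Ω E : Type*} [MeasurableSpace Ω] [MeasurableSpace E]

open Classical in
/-- The number of points in `A`, counted with multiplicity: the value at `A` of the random
counting measure. -/
noncomputable def count (η : PointProcess Ω E) (A : Set E) (ω : Ω) : ℕ :=
  ((Finset.range (η.N ω)).filter fun i => η.X i ω ∈ A).card

open Classical in
/-- The random point set: the support of the random counting measure. -/
noncomputable def points (η : PointProcess Ω E) (ω : Ω) : Finset E :=
  (Finset.range (η.N ω)).image fun i => η.X i ω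

end PointProcess

/-- `η` is a homogeneous Poisson point process of intensity `t` supported in `W`: all points lie in
`W`, the number of points in a Borel set `A` is Poisson distributed with mean `t · vol(A ∩ W)`, and
the numbers of points in pairwise disjoint Borel sets are independent. -/
structure IsPoissonProcess {Ω : Type*} [MeasurableSpace Ω] (P : Measure Ω) {d : ℕ}
    (W : Set (EuclideanSpace ℝ (Fin d))) (t : ℝ)
    (η : PointProcess Ω (EuclideanSpace ℝ (Fin d))) : Prop where
  mem : ∀ ω, ∀ i < η.N ω, η.X i ω ∈ W
  map_count : ∀ A : Set (EuclideanSpace ℝ (Fin d)), MeasurableSet A →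
    P.map (η.count A) = poissonMeasure (ENNReal.ofReal t * volume (A ∩ W)).toNNReal
  indep : ∀ (m : ℕ) (A : Fin m → Set (EuclideanSpace ℝ (Fin d))), (∀ i, MeasurableSet (A i)) →
    (Pairwise fun i j => Disjoint (A i) (A j)) → iIndepFun (fun i => η.count (A i)) P

section Functionals

variable {Ω : Type*} [MeasurableSpace Ω] {d : ℕ}

/-- The length power functional `L^{(τ)}` of the random geometric graph with vertex set `η` and
distance `δ`. -/
noncomputable def L (η : PointProcess Ω (EuclideanSpace ℝ (Fin d))) (δ τ : ℝ) (ω : Ω) : ℝ :=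
  lengthPower (η.points ω) δ τ

/-- The centered and normalized length power functional
`(L - 𝔼 L) / max {t δ^{τ+d/2}, t^{3/2} δ^{τ+d}}`. -/
noncomputable def normL (P : Measure Ω) (t : ℝ)
    (η : PointProcess Ω (EuclideanSpace ℝ (Fin d))) (δ τ : ℝ) (ω : Ω) : ℝ :=
  (L η δ τ ω - ∫ ω', L η δ τ ω' ∂P) /
    max (t * δ ^ (τ + (d : ℝ) / 2)) (t ^ (3 / 2 : ℝ) * δ ^ (τ + (d : ℝ)))

end Functionals

/-- For `τ = 0` the length power functional is the number of edges of the geometric graph. -/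
theorem lengthPower_zero {E : Type*} [NormedAddCommGroup E] (S : Finset E) (δ : ℝ) :
    lengthPower S δ 0 = (Nat.card (geometricGraph S δ).edgeSet : ℝ) := by
  classical
  have h := (geometricGraph S δ).sum_degrees_eq_twice_card_edges
  have h1 : (Nat.card (geometricGraph S δ).edgeSet) = (geometricGraph S δ).edgeFinset.card := by
    rw [Nat.card_eq_fintype_card, SimpleGraph.edgeFinset_card]
  have h2 : (∑ p ∈ S.offDiag, if ‖p.1 - p.2‖ ≤ δ then ‖p.1 - p.2‖ ^ (0 : ℝ) else 0)
      = ((∑ v, (geometricGraph S δ).degree v : ℕ) : ℝ) := by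
    have h3 : ∀ v : {x // x ∈ S}, ((geometricGraph S δ).degree v : ℝ)
        = ∑ y ∈ S, if v.1 ≠ y ∧ ‖v.1 - y‖ ≤ δ then (1 : ℝ) else 0 := by
      intro v
      rw [← Finset.sum_coe_sort S, ← SimpleGraph.card_neighborFinset_eq_degree,
        SimpleGraph.neighborFinset_eq_filter, Finset.card_filter]
      push_cast
      refine Finset.sum_congr rfl fun y _ => ?_
      have e : (geometricGraph S δ).Adj v y ↔ v.1 ≠ y.1 ∧ ‖v.1 - y.1‖ ≤ δ :=
        and_congr_left' (not_congr Subtype.ext_iff)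
      simp only [e]
    push_cast
    rw [Finset.sum_congr rfl fun v _ => h3 v,
      Finset.sum_coe_sort S fun x => ∑ y ∈ S, if x ≠ y ∧ ‖x - y‖ ≤ δ then (1 : ℝ) else 0,
      ← Finset.sum_product', ← Finset.diag_union_offDiag,
      Finset.sum_union (Finset.disjoint_diag_offDiag S)]
    rw [Finset.sum_eq_zero (s := S.diag), zero_add]
    · refine Finset.sum_congr rfl fun p hp => ?_
      simp [(Finset.mem_offDiag.1 hp).2.2]
    · intro p hp
      simp [(Finset.mem_diag.1 hp).2]
  rw [lengthPower, h2, h, h1]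
  push_cast
  ring

end RandomGeometricGraph

/-! With `a = τ + d`, twice the length functional is a pair sum over a Poisson process with the
kernel `‖x - y‖ ^ τ` cut off at distance `δ`. For the difference of two weighted pair sums, the
variance splits into 4 times the squared `L²` norm of the difference of the weighted potentials `∫
g(x, y) μ(dy)`, and a diagonal term made of second moments of the kernels
(`variance_pairSum_sub_le`).

If the ball of radius `δ` around `x` lies in `W`, polar coordinates give the potential exactly: `t ·
d κ · δ ^ a / a`, where `κ` is the volume of the unit ball. In the supercritical regime the
normalization is `t ^ (3/2) δ ^ a`, so the potential multiplied by `a` and normalized no longer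
depends on `τ`. The two potentials therefore cancel except within `δ` of the frontier of `W`, and
the first term is at most a constant times the volume of that layer
(`integral_sq_sub_scaled_potential_le`). This volume vanishes as `δ → 0`, because the frontier of a
convex set is null. The diagonal term is `O(1 / (t δ ^ d))` (`scaled_second_moment_le`). Chebyshev's
inequality concludes.

The variance formula rests on the Campbell formula, `HasPoissonCounts.lintegral_injSum`, which is
derived from the counts alone: independence determines the factorial moment measures on boxes with
disjoint sides, and these suffice since neither measure charges tuples with a repeated entry. -/

open Metric
open scoped ENNReal NNReal

/-! ### Mean and two-point tail of the Poisson law -/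

namespace ProbabilityTheory

theorem lintegral_natCast_poissonMeasure (r : ℝ≥0) :
    ∫⁻ n, (n : ℝ≥0∞) ∂poissonMeasure r = r := by
  have h : ∀ f : ℕ → ℝ≥0∞, ∫⁻ n, f n ∂poissonMeasure r
      = ∑' n, ENNReal.ofReal (Real.exp (-r) * r ^ n / n.factorial) * f n := by
    intro f
    simp [poissonMeasure, lintegral_sum_measure, lintegral_smul_measure]
  have h1 : ∑' n, ENNReal.ofReal (Real.exp (-r) * r ^ n / n.factorial) = 1 := by
    have := h fun _ => 1
    simpa using this.symm
  rw [h, tsum_eq_zero_add' ENNReal.summable]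
  have h2 : ∀ n : ℕ, ENNReal.ofReal (Real.exp (-r) * r ^ (n + 1) / (n + 1).factorial)
      * ((n + 1 : ℕ) : ℝ≥0∞) = r * ENNReal.ofReal (Real.exp (-r) * r ^ n / n.factorial) := by
    intro n
    rw [← ENNReal.ofReal_natCast, ← ENNReal.ofReal_mul (by positivity),
      ← ENNReal.ofReal_coe_nnreal, ← ENNReal.ofReal_mul (by positivity)]
    congr 1
    have : ((n + 1 : ℕ) : ℝ) ≠ 0 := by positivity
    have : (n.factorial : ℝ) ≠ 0 := by positivity
    rw [Nat.factorial_succ]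
    push_cast at *
    field_simp
    ring
  simp only [h2, ENNReal.tsum_mul_left, h1]
  simp

/-- Since `exp (-r) ≥ 1 - r`, the tail `1 - exp (-r) (1 + r)` is at most `1 - (1 - r) (1 + r)`. The
quadratic order is what makes the probability of a multiple point vanish when summed over a fine
partition. -/
theorem poissonMeasure_two_le (r : ℝ≥0) : poissonMeasure r {n | 2 ≤ n} ≤ (r : ℝ≥0∞) ^ 2 := by
  have hs : {n : ℕ | 2 ≤ n} = ({0, 1} : Set ℕ)ᶜ := by
    ext n
    simp only [Set.mem_ofPred_eq, Set.mem_compl_iff, Set.mem_insert_iff, Set.mem_singleton_iff]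
    omega
  have h0 : (poissonMeasure r).real {0, 1} = Real.exp (-r) + Real.exp (-r) * r := by
    rw [Set.insert_eq, measureReal_union (by simp) (measurableSet_singleton _),
      poissonMeasure_real_singleton, poissonMeasure_real_singleton]
    simp
  have h1 : (poissonMeasure r).real {n | 2 ≤ n} ≤ (r : ℝ) ^ 2 := by
    rw [hs, probReal_compl_eq_one_sub (MeasurableSet.of_discrete), h0]
    have := Real.one_sub_le_exp_neg (r : ℝ)
    nlinarith [r.2]
  rw [← ENNReal.ofReal_toReal (measure_ne_top (poissonMeasure r) {n | 2 ≤ n}),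
    ← ENNReal.ofReal_coe_nnreal, ← ENNReal.ofReal_pow r.coe_nonneg]
  exact ENNReal.ofReal_le_ofReal h1

end ProbabilityTheory

/-! ### Absence of multiple points -/

namespace MeasureTheory

/-- An atomless finite measure on a separable metric space admits countable measurable partitions
into pieces of arbitrarily small measure. -/
theorem exists_partition_measure_le {E : Type*} [PseudoMetricSpace E] [SecondCountableTopology E]
    [MeasurableSpace E] [BorelSpace E] [Nonempty E] (μ : Measure E) [IsFiniteMeasure μ] [NullSingletonClass μ]
    {ε : ℝ≥0∞} (hε : 0 < ε) :
    ∃ s : ℕ → Set E, (∀ i, MeasurableSet (s i)) ∧ Pairwise (Function.onFun Disjoint s) ∧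
      ⋃ i, s i = Set.univ ∧ ∀ i, μ (s i) ≤ ε := by
  -- Singletons are null, so outer regularity yields small open neighbourhoods; countably many
  -- cover, and `disjointed` turns them into a partition.
  have h : ∀ x : E, ∃ U : Set E, x ∈ U ∧ IsOpen U ∧ μ U < ε := by
    intro x
    obtain ⟨U, hU, hUo, hUε⟩ := Set.exists_isOpen_lt_of_lt (μ := μ) {x} ε (by simpa using hε)
    exact ⟨U, hU rfl, hUo, hUε⟩
  choose U hxU hUo hUε using h
  obtain ⟨c, hc, hcU⟩ := TopologicalSpace.countable_cover_nhds fun x => (hUo x).mem_nhds (hxU x)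
  have hcn : c.Nonempty := by
    by_contra hne
    rw [Set.not_nonempty_iff_eq_empty] at hne
    subst hne
    simp only [Set.mem_empty_iff_false, Set.iUnion_of_empty, Set.iUnion_empty] at hcU
    exact Set.empty_ne_univ hcU
  obtain ⟨x, rfl⟩ := hc.exists_eq_range hcn
  refine ⟨disjointed fun n => U (x n), MeasurableSet.disjointed fun n => (hUo _).measurableSet,
    disjoint_disjointed _, ?_, fun i => ?_⟩
  · rw [iUnion_disjointed]
    simpa using hcU
  · exact (measure_mono (disjointed_subset _ _)).trans (hUε _).le

end MeasureTheory

namespace RandomGeometricGraph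

/-- The number of points takes countably many values, so measurability may be checked with that
number frozen. -/
theorem PointProcess.measurable_of_N {Ω E β : Type*} [MeasurableSpace Ω] [MeasurableSpace E]
    [MeasurableSpace β] (η : PointProcess Ω E) {Φ : ℕ → Ω → β} (hΦ : ∀ n, Measurable (Φ n)) :
    Measurable fun ω => Φ (η.N ω) ω :=
  (measurable_from_prod_countable_right (f := fun p : ℕ × Ω => Φ p.1 p.2) hΦ).comp
    (η.measurable_N.prodMk measurable_id)

theorem PointProcess.measurable_count {Ω E : Type*} [MeasurableSpace Ω] [MeasurableSpace E]
    (η : PointProcess Ω E) {A : Set E} (hA : MeasurableSet A) : Measurable (η.count A) := by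
  classical
  have h : η.count A = fun ω => ∑ i ∈ Finset.range (η.N ω), if η.X i ω ∈ A then 1 else 0 := by
    funext ω
    rw [← Finset.card_filter]
    unfold PointProcess.count
    congr
  rw [h]
  refine η.measurable_of_N (Φ := fun n ω => ∑ i ∈ Finset.range n, if η.X i ω ∈ A then 1 else 0)
    fun n => Finset.measurable_sum _ fun i _ => ?_
  exact Measurable.ite (η.measurable_X i hA) measurable_const measurable_const

/-- The finite-dimensional laws of a Poisson process with intensity measure `μ`: the numbers of
points in measurable sets are Poisson distributed and independent for disjoint sets. -/
structure HasPoissonCounts {Ω E : Type*} [MeasurableSpace Ω] [MeasurableSpace E] (P : Measure Ω)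
    (η : PointProcess Ω E) (μ : Measure E) : Prop where
  map_count : ∀ A, MeasurableSet A → P.map (η.count A) = poissonMeasure (μ A).toNNReal
  indep : ∀ (m : ℕ) (A : Fin m → Set E), (∀ i, MeasurableSet (A i)) →
    (Pairwise fun i j => Disjoint (A i) (A j)) → iIndepFun (fun i => η.count (A i)) P

namespace HasPoissonCounts

variable {Ω E : Type*} [MeasurableSpace Ω] [MeasurableSpace E] {P : Measure Ω}
  {η : PointProcess Ω E} {μ : Measure E}

theorem lintegral_count [IsFiniteMeasure μ] (h : HasPoissonCounts P η μ) {A : Set E}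
    (hA : MeasurableSet A) : ∫⁻ ω, (η.count A ω : ℝ≥0∞) ∂P = μ A := by
  rw [← lintegral_map' (f := fun n : ℕ => (n : ℝ≥0∞)) Measurable.of_discrete.aemeasurable
    (η.measurable_count hA).aemeasurable, h.map_count A hA, lintegral_natCast_poissonMeasure,
    ENNReal.coe_toNNReal (measure_ne_top μ A)]

theorem measure_two_le_count [IsFiniteMeasure μ] (h : HasPoissonCounts P η μ) {A : Set E}
    (hA : MeasurableSet A) : P {ω | 2 ≤ η.count A ω} ≤ μ A ^ 2 := by
  have := poissonMeasure_two_le (μ A).toNNReal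
  rwa [← h.map_count A hA, Measure.map_apply_of_aemeasurable (η.measurable_count hA).aemeasurable
    MeasurableSet.of_discrete, ENNReal.coe_toNNReal (measure_ne_top μ A)] at this

end HasPoissonCounts

/-- A Poisson process with atomless intensity has almost surely no multiple points. -/
theorem HasPoissonCounts.ae_injOn {Ω E : Type*} [MeasurableSpace Ω] {P : Measure Ω}
    [PseudoMetricSpace E] [SecondCountableTopology E] [MeasurableSpace E] [BorelSpace E]
    {η : PointProcess Ω E} {μ : Measure E} [IsFiniteMeasure μ] [NullSingletonClass μ]
    (h : HasPoissonCounts P η μ) :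
    ∀ᵐ ω ∂P, Set.InjOn (fun i => η.X i ω) (Finset.range (η.N ω)) := by
  classical
  rcases isEmpty_or_nonempty Ω with hΩ | ⟨⟨ω₀⟩⟩
  · exact Filter.Eventually.of_forall fun ω => hΩ.elim ω
  have : Nonempty E := ⟨η.X 0 ω₀⟩
  set B := {ω | ¬ Set.InjOn (fun i => η.X i ω) (Finset.range (η.N ω))}
  change P B = 0
  -- Coinciding points share a cell of every partition. Summing `μ (s l) ^ 2 ≤ ε * μ (s l)` over
  -- cells of mass at most `ε` bounds the probability by `ε * μ univ`.
  have key : ∀ ε : ℝ≥0∞, 0 < ε → P B ≤ ε * μ Set.univ := by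
    intro ε hε
    obtain ⟨s, hsm, hsd, hsu, hsε⟩ := exists_partition_measure_le μ hε
    have hsub : B ⊆ ⋃ l, {ω | 2 ≤ η.count (s l) ω} := by
      intro ω hω
      simp only [B, Set.mem_ofPred_eq, Set.InjOn, not_forall] at hω
      obtain ⟨i, hi, j, hj, hij, hne⟩ := hω
      obtain ⟨l, hl⟩ := Set.mem_iUnion.1 (hsu.symm ▸ Set.mem_univ (η.X i ω))
      refine Set.mem_iUnion.2 ⟨l, ?_⟩
      refine Finset.one_lt_card.2 ?_
      refine ⟨i, ?_, j, ?_, hne⟩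
      · exact Finset.mem_filter.2 ⟨Finset.mem_coe.1 hi, hl⟩
      · refine Finset.mem_filter.2 ⟨Finset.mem_coe.1 hj, ?_⟩
        have hij' : η.X i ω = η.X j ω := hij
        exact hij' ▸ hl
    calc P B ≤ ∑' l, P {ω | 2 ≤ η.count (s l) ω} := (measure_mono hsub).trans (measure_iUnion_le _)
      _ ≤ ∑' l, ε * μ (s l) := by
        refine ENNReal.tsum_le_tsum fun l => (h.measure_two_le_count (hsm l)).trans ?_
        rw [sq]
        gcongr
        exact hsε l
      _ = ε * μ Set.univ := by
        rw [ENNReal.tsum_mul_left, ← measure_iUnion hsd hsm, hsu]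
  have hlim : Tendsto (fun ε : ℝ≥0∞ => ε * μ Set.univ) (𝓝[>] 0) (𝓝 0) := by
    have := (ENNReal.continuous_mul_const (measure_ne_top μ Set.univ)).tendsto 0
    simp only [zero_mul] at this
    exact this.mono_left nhdsWithin_le_nhds
  exact le_antisymm (ge_of_tendsto hlim (eventually_nhdsWithin_of_forall key)) bot_le

end RandomGeometricGraph

/-! ### Factorial moment measures and the Campbell formula -/

namespace MeasureTheory

variable {E : Type*} [MeasurableSpace E]

/-- Fubini with coordinate `i` singled out: once the others are fixed, the condition confines `x i`
to a single point, which is null. -/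
theorem Measure.pi_setOf_eq_eq_zero [MeasurableSingletonClass E] [MeasurableEq E] (μ : Measure E)
    [SigmaFinite μ] [NullSingletonClass μ] {k : ℕ} {i j : Fin k} (hij : i ≠ j) :
    Measure.pi (fun _ : Fin k => μ) {x | x i = x j} = 0 := by
  obtain _ | n := k
  · exact i.elim0
  obtain ⟨l, rfl⟩ := Fin.exists_succAbove_eq hij.symm
  have hp := measurePreserving_piFinSuccAbove (fun _ : Fin (n + 1) => μ) i
  have hm : MeasurableSet {p : E × (Fin n → E) | p.1 = p.2 l} :=
    measurableSet_eq_fun measurable_fst ((measurable_pi_apply l).comp measurable_snd)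
  have hpre : {x : Fin (n + 1) → E | x i = x (i.succAbove l)}
      = MeasurableEquiv.piFinSuccAbove (fun _ => E) i ⁻¹' {p | p.1 = p.2 l} := by
    ext x
    simp [MeasurableEquiv.piFinSuccAbove, Fin.insertNthEquiv, Fin.removeNth]
  rw [hpre, hp.measure_preimage hm.nullMeasurableSet, Measure.prod_apply_symm hm]
  simp

theorem Measure.pi_not_injective_eq_zero [MeasurableSingletonClass E] [MeasurableEq E]
    (μ : Measure E) [SigmaFinite μ] [NullSingletonClass μ] (k : ℕ) :
    Measure.pi (fun _ : Fin k => μ) {x | ¬ Function.Injective x} = 0 := by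
  have h : {x : Fin k → E | ¬ Function.Injective x}
      ⊆ ⋃ p : {p : Fin k × Fin k // p.1 ≠ p.2}, {x | x p.1.1 = x p.1.2} := by
    intro x hx
    simp only [Function.Injective, Set.mem_ofPred_eq, not_forall] at hx
    obtain ⟨i, j, h, hij⟩ := hx
    exact Set.mem_iUnion.2 ⟨⟨(i, j), hij⟩, h⟩
  refine measure_mono_null h (measure_iUnion_null fun p => ?_)
  exact Measure.pi_setOf_eq_eq_zero μ p.2

/-- Two measures on `Fin k → E` which do not charge the tuples with a repeated entry agree as soon
as they agree on boxes with pairwise disjoint sides. -/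
theorem Measure.pi_eq_of_disjoint [TopologicalSpace E] [T2Space E] [SecondCountableTopology E]
    [BorelSpace E] (μ : Measure E) [SigmaFinite μ] {k : ℕ}
    {ν : Measure (Fin k → E)} (hμ : Measure.pi (fun _ : Fin k => μ) {x | ¬ Function.Injective x} = 0)
    (hν : ν {x | ¬ Function.Injective x} = 0)
    (h : ∀ A : Fin k → Set E, (∀ j, MeasurableSet (A j)) →
      (Pairwise fun i j => Disjoint (A i) (A j)) → ν (Set.univ.pi A) = ∏ j, μ (A j)) :
    Measure.pi (fun _ : Fin k => μ) = ν := by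
  let b := TopologicalSpace.countableBasis E
  have hb := TopologicalSpace.isBasis_countableBasis E
  have : Countable b := (TopologicalSpace.countable_countableBasis E).to_subtype
  -- Distinct points have disjoint basic neighbourhoods, so these countably many boxes cover all
  -- injective tuples. Inside one of them every smaller box again has disjoint sides, so the
  -- hypothesis identifies the two restricted measures.
  let I := {U : Fin k → b // Pairwise fun i j => Disjoint (U i : Set E) (U j)}
  let s : I → Set (Fin k → E) := fun U => Set.univ.pi fun j => (U.1 j : Set E)
  have hcover : (⋃ U, s U)ᶜ ⊆ {x | ¬ Function.Injective x} := by
    intro x hx hinj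
    refine hx (Set.mem_iUnion.2 ?_)
    obtain ⟨V, hV, hVd⟩ := (Set.finite_range x).t2_separation
    have hex : ∀ j, ∃ u ∈ b, x j ∈ u ∧ u ⊆ V (x j) := fun j =>
      hb.exists_subset_of_mem_open (hV _).1 (hV _).2
    choose u hub hxu huV using hex
    refine ⟨⟨fun j => ⟨u j, hub j⟩, fun i j hij => ?_⟩, fun j _ => hxu j⟩
    exact (hVd ⟨i, rfl⟩ ⟨j, rfl⟩ (hinj.ne hij)).mono (huV i) (huV j)
  have hres : Measure.restrict (Measure.pi fun _ : Fin k => μ) (⋃ U, s U)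
      = ν.restrict (⋃ U, s U) := by
    rw [Measure.restrict_iUnion_congr]
    rintro ⟨U, hU⟩
    have hUm : ∀ j, MeasurableSet (U j : Set E) := fun j => (hb.isOpen (U j).2).measurableSet
    simp only [s]
    rw [Measure.restrict_pi_pi]
    refine Measure.pi_eq fun B hB => ?_
    rw [Measure.restrict_apply (MeasurableSet.univ_pi hB), ← Set.pi_inter_distrib,
      h _ (fun j => (hB j).inter (hUm j))
        fun i j hij => (hU hij).mono Set.inter_subset_right Set.inter_subset_right]
    exact Finset.prod_congr rfl fun j _ => (Measure.restrict_apply (hB j)).symm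
  rwa [Measure.restrict_eq_self_of_ae_mem, Measure.restrict_eq_self_of_ae_mem] at hres
  · exact measure_mono_null hcover hν
  · exact measure_mono_null hcover hμ

/-- Integration of a function of `n + 1` variables against a product measure, one variable first. -/
theorem lintegral_pi_succ (μ : Measure E) [SigmaFinite μ] {n : ℕ} {f : (Fin (n + 1) → E) → ℝ≥0∞}
    (hf : Measurable f) : ∫⁻ x, f x ∂Measure.pi (fun _ => μ)
      = ∫⁻ a, ∫⁻ x, f (Fin.cons a x) ∂Measure.pi (fun _ => μ) ∂μ := by
  have hp := (measurePreserving_piFinSuccAbove (fun _ : Fin (n + 1) => μ) 0).symm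
  rw [← hp.lintegral_comp hf, lintegral_prod]
  · simp [MeasurableEquiv.piFinSuccAbove, Fin.insertNthEquiv]
  · exact (hf.comp (MeasurableEquiv.measurable _)).aemeasurable

end MeasureTheory

/-- The sum of `φ` over all injective `k`-tuples of elements of `S`. -/
noncomputable def Finset.injSum {ι R : Type*} [AddCommMonoid R] (S : Finset ι) (k : ℕ)
    (φ : (Fin k → ι) → R) : R :=
  open Classical in ∑ f ∈ Fintype.piFinset fun _ : Fin k => S with Function.Injective f, φ f

namespace RandomGeometricGraph

variable {Ω E : Type*} [MeasurableSpace Ω] [MeasurableSpace E]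

open Classical in
/-- The `k`-th factorial moment measure of a point process: the intensity measure of the `k`-tuples
of points with distinct indices. -/
noncomputable def PointProcess.factorialMoment (η : PointProcess Ω E) (P : Measure Ω) (k : ℕ) :
    Measure (Fin k → E) :=
  Measure.sum fun f : Fin k → ℕ =>
    if Function.Injective f then
      (P.restrict {ω | ∀ j, f j < η.N ω}).map fun ω j => η.X (f j) ω
    else 0

theorem PointProcess.measurableSet_forall_lt_N (η : PointProcess Ω E) {k : ℕ} (f : Fin k → ℕ) :
    MeasurableSet {ω | ∀ j, f j < η.N ω} :=
  measurableSet_setOfPred.2 <| Measurable.forall fun _ =>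
    measurableSet_setOfPred.1 (η.measurable_N measurableSet_Ioi)

theorem PointProcess.measurable_tuple (η : PointProcess Ω E) {k : ℕ} (f : Fin k → ℕ) :
    Measurable fun ω j => η.X (f j) ω :=
  measurable_pi_lambda _ fun j => η.measurable_X (f j)

/-- Tonelli exchanges the sum over index tuples with the expectation; for each `ω` only tuples with
entries below `η.N ω` survive, leaving a finite sum. -/
theorem PointProcess.lintegral_factorialMoment (η : PointProcess Ω E) (P : Measure Ω) {k : ℕ}
    {φ : (Fin k → E) → ℝ≥0∞} (hφ : Measurable φ) :
    ∫⁻ x, φ x ∂η.factorialMoment P k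
      = ∫⁻ ω, (Finset.range (η.N ω)).injSum k (fun f => φ fun j => η.X (f j) ω) ∂P := by
  classical
  rw [PointProcess.factorialMoment, lintegral_sum_measure]
  have h : ∀ f : Fin k → ℕ, ∫⁻ x, φ x ∂(if Function.Injective f then
      (P.restrict {ω | ∀ j, f j < η.N ω}).map fun ω j => η.X (f j) ω else 0)
      = ∫⁻ ω, if Function.Injective f ∧ ∀ j, f j < η.N ω then φ (fun j => η.X (f j) ω) else 0
        ∂P := by
    intro f
    by_cases hf : Function.Injective f
    · simp only [hf, if_true, true_and]
      rw [lintegral_map hφ (η.measurable_tuple f),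
        ← lintegral_indicator (η.measurableSet_forall_lt_N f)]
      simp only [Set.indicator_apply, Set.mem_ofPred_eq]
    · simp [hf]
  simp_rw [h]
  rw [← lintegral_tsum]
  · refine lintegral_congr fun ω => ?_
    rw [Finset.injSum, tsum_eq_sum (s := (Fintype.piFinset fun _ : Fin k => Finset.range (η.N ω)))]
    · rw [Finset.sum_filter]
      refine Finset.sum_congr rfl fun f hf => ?_
      have hf' : ∀ j, f j < η.N ω := by simpa using hf
      simp [hf']
    · intro f hf
      have hf' : ¬ ∀ j, f j < η.N ω := by simpa using hf
      rw [if_neg fun h => hf' h.2]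
  · intro f
    refine Measurable.aemeasurable ?_
    by_cases hf : Function.Injective f
    · simp only [hf, true_and]
      exact Measurable.ite (η.measurableSet_forall_lt_N f) (hφ.comp (η.measurable_tuple f))
        measurable_const
    · simp [hf]

/-- Disjoint sides force distinct indices, so injectivity costs nothing and the number of admissible
tuples factorizes. -/
theorem PointProcess.injSum_indicator_eq_prod_count (η : PointProcess Ω E) {k : ℕ}
    {A : Fin k → Set E} (hA : Pairwise fun i j => Disjoint (A i) (A j)) (ω : Ω) :
    (Finset.range (η.N ω)).injSum k
      (fun f => (Set.univ.pi A).indicator (fun _ => (1 : ℝ≥0∞)) fun j => η.X (f j) ω)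
      = ∏ j, (η.count (A j) ω : ℝ≥0∞) := by
  classical
  rw [Finset.injSum]
  simp only [Set.indicator_apply, PointProcess.count]
  rw [← Finset.sum_filter, Finset.sum_const, nsmul_one, ← Nat.cast_prod]
  congr 1
  have := Fintype.card_piFinset
    fun j => (Finset.range (η.N ω)).filter fun i => η.X i ω ∈ A j
  convert! this using 2
  ext f
  simp only [Finset.mem_filter, Fintype.mem_piFinset, Finset.mem_range, Set.mem_pi, Set.mem_univ,
    true_imp_iff]
  constructor
  · rintro ⟨⟨h1, -⟩, h2⟩ j
    exact ⟨h1 j, h2 j⟩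
  · intro h
    refine ⟨⟨fun j => (h j).1, fun i j hij => ?_⟩, fun j => (h j).2⟩
    by_contra hne
    exact Set.disjoint_left.1 (hA hne) (h i).2 (hij ▸ (h j).2)

/-- The factorial moment measures of a Poisson process are the powers of its intensity measure. -/
theorem HasPoissonCounts.factorialMoment_eq {E : Type*} [MetricSpace E]
    [SecondCountableTopology E] [MeasurableSpace E] [BorelSpace E] {P : Measure Ω}
    {η : PointProcess Ω E} {μ : Measure E} [IsFiniteMeasure μ] [NullSingletonClass μ]
    (h : HasPoissonCounts P η μ) (k : ℕ) :
    η.factorialMoment P k = Measure.pi fun _ => μ := by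
  refine (Measure.pi_eq_of_disjoint μ (Measure.pi_not_injective_eq_zero μ k) ?_ ?_).symm
  · classical
    have hm : MeasurableSet {x : Fin k → E | ¬ Function.Injective x} := by
      have : {x : Fin k → E | ¬ Function.Injective x} = ⋃ i, ⋃ j, {x | i ≠ j ∧ x i = x j} := by
        ext x
        simp only [Function.Injective, Set.mem_ofPred_eq, not_forall, Set.mem_iUnion]
        exact exists_congr fun i => exists_congr fun j => by tauto
      rw [this]
      refine MeasurableSet.iUnion fun i => MeasurableSet.iUnion fun j => ?_
      exact (MeasurableSet.const _).inter
        (measurableSet_eq_fun (measurable_pi_apply i) (measurable_pi_apply j))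
    rw [← lintegral_indicator_one hm, η.lintegral_factorialMoment P (measurable_one.indicator hm),
      lintegral_eq_zero_iff' ?_]
    · filter_upwards [h.ae_injOn] with ω hω
      refine Finset.sum_eq_zero fun f hf => Set.indicator_of_notMem ?_ _
      simp only [Finset.mem_filter, Fintype.mem_piFinset] at hf
      exact not_not.2 fun i j hij => hf.2 (hω (hf.1 i) (hf.1 j) hij)
    · refine (η.measurable_of_N (Φ := fun n ω => (Finset.range n).injSum k fun f =>
        {x : Fin k → E | ¬ Function.Injective x}.indicator (1 : (Fin k → E) → ℝ≥0∞) fun j => η.X (f j) ω)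
        fun n => Finset.measurable_sum _ fun f _ => ?_).aemeasurable
      exact (measurable_one.indicator hm).comp (η.measurable_tuple f)
  · intro A hA hd
    have hbox := MeasurableSet.univ_pi hA
    rw [← lintegral_indicator_one hbox,
      η.lintegral_factorialMoment P (measurable_one.indicator hbox)]
    calc _ = ∫⁻ ω, ∏ j, (η.count (A j) ω : ℝ≥0∞) ∂P :=
          lintegral_congr fun ω => η.injSum_indicator_eq_prod_count hd ω
      _ = ∏ j, ∫⁻ ω, (η.count (A j) ω : ℝ≥0∞) ∂P := by
        refine lintegral_prod_eq_prod_lintegral_of_indepFun _ _ ?_ fun j => ?_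
        · exact (h.indep k A hA hd).comp (fun _ n => (n : ℝ≥0∞)) fun _ => Measurable.of_discrete
        · exact Measurable.of_discrete.comp (η.measurable_count (hA j))
      _ = ∏ j, μ (A j) := Finset.prod_congr rfl fun j _ => h.lintegral_count (hA j)

/-- The multivariate Campbell formula for Poisson processes. -/
theorem HasPoissonCounts.lintegral_injSum {E : Type*} [MetricSpace E]
    [SecondCountableTopology E] [MeasurableSpace E] [BorelSpace E] {P : Measure Ω}
    {η : PointProcess Ω E} {μ : Measure E} [IsFiniteMeasure μ] [NullSingletonClass μ]
    (h : HasPoissonCounts P η μ) {k : ℕ} {φ : (Fin k → E) → ℝ≥0∞} (hφ : Measurable φ) :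
    ∫⁻ ω, (Finset.range (η.N ω)).injSum k (fun f => φ fun j => η.X (f j) ω) ∂P
      = ∫⁻ x, φ x ∂Measure.pi (fun _ => μ) := by
  rw [← η.lintegral_factorialMoment P hφ, h.factorialMoment_eq]

end RandomGeometricGraph

/-! ### Combinatorics of sums over injective tuples -/

namespace Finset

variable {ι R : Type*} [DecidableEq ι]

theorem injSum_zero [AddCommMonoid R] (S : Finset ι) (φ : (Fin 0 → ι) → R) :
    S.injSum 0 φ = φ Fin.elim0 := by
  classical
  have h : (Fintype.piFinset fun _ : Fin 0 => S).filter Function.Injective = {Fin.elim0} := by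
    ext f
    simp only [mem_filter, Fintype.mem_piFinset, mem_singleton]
    exact ⟨fun _ => Subsingleton.elim _ _, fun _ => ⟨fun j => j.elim0, fun j => j.elim0⟩⟩
  rw [injSum]
  convert! sum_singleton φ Fin.elim0

theorem injSum_succ [AddCommMonoid R] (S : Finset ι) (k : ℕ) (φ : (Fin (k + 1) → ι) → R) :
    S.injSum (k + 1) φ = ∑ x ∈ S, (S.erase x).injSum k fun f => φ (Fin.cons x f) := by
  classical
  simp only [injSum]
  rw [sum_sigma']
  refine sum_nbij' (fun f => ⟨f 0, Fin.tail f⟩) (fun p => Fin.cons p.1 p.2) ?_ ?_ ?_ ?_ ?_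
  · intro f hf
    simp only [mem_filter, Fintype.mem_piFinset, mem_sigma, mem_erase] at hf ⊢
    exact ⟨hf.1 0, fun j => ⟨fun h => Fin.succ_ne_zero j (hf.2 h), hf.1 _⟩,
      hf.2.comp (Fin.succ_injective k)⟩
  · rintro ⟨x, f⟩ hf
    simp only [mem_filter, Fintype.mem_piFinset, mem_sigma, mem_erase] at hf ⊢
    refine ⟨fun j => ?_, Fin.cons_injective_iff.2 ⟨?_, hf.2.2⟩⟩
    · induction j using Fin.cases with
      | zero => exact hf.1
      | succ j => exact (hf.2.1 j).2
    · rintro ⟨j, hj⟩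
      exact (hf.2.1 j).1 hj
  · intro f _
    exact Fin.cons_self_tail f
  · rintro ⟨x, f⟩ _
    simp
  · intro f _
    simp [Fin.cons_self_tail]

theorem injSum_two [AddCommMonoid R] (S : Finset ι) (φ : ι → ι → R) :
    S.injSum 2 (fun f => φ (f 0) (f 1)) = ∑ x ∈ S, ∑ y ∈ S.erase x, φ x y := by
  simp only [injSum_succ, injSum_zero]
  rfl

theorem injSum_three [AddCommMonoid R] (S : Finset ι) (φ : ι → ι → ι → R) :
    S.injSum 3 (fun f => φ (f 0) (f 1) (f 2))
      = ∑ x ∈ S, ∑ y ∈ S.erase x, ∑ z ∈ (S.erase x).erase y, φ x y z := by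
  simp only [injSum_succ, injSum_zero]
  rfl

theorem injSum_four [AddCommMonoid R] (S : Finset ι) (φ : ι → ι → ι → ι → R) :
    S.injSum 4 (fun f => φ (f 0) (f 1) (f 2) (f 3))
      = ∑ x ∈ S, ∑ y ∈ S.erase x, ∑ z ∈ (S.erase x).erase y,
        ∑ w ∈ ((S.erase x).erase y).erase z, φ x y z w := by
  simp only [injSum_succ, injSum_zero]
  rfl

theorem sum_sum_erase_swap [AddCommMonoid R] (S : Finset ι) (φ : ι → ι → R) :
    ∑ x ∈ S, ∑ y ∈ S.erase x, φ x y = ∑ x ∈ S, ∑ y ∈ S.erase x, φ y x := by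
  refine sum_comm' fun x y => ?_
  simp only [mem_erase]
  tauto

/-- The new ordered pairs are those containing `a`, in either position; symmetry of `K` gives the
factor 2. -/
theorem sum_sum_erase_insert [CommSemiring R] {T : Finset ι} {a : ι} (ha : a ∉ T) {K : ι → ι → R}
    (hK : ∀ x y, K x y = K y x) :
    ∑ z ∈ insert a T, ∑ w ∈ (insert a T).erase z, K z w
      = ∑ z ∈ T, ∑ w ∈ T.erase z, K z w + 2 * ∑ z ∈ T, K a z := by
  rw [sum_insert ha, erase_insert ha]
  have h : ∀ z ∈ T, ∑ w ∈ (insert a T).erase z, K z w = K a z + ∑ w ∈ T.erase z, K z w := by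
    intro z hz
    have hne : a ≠ z := fun h => ha (h ▸ hz)
    rw [erase_insert_of_ne hne, sum_insert fun h => ha (mem_of_mem_erase h), hK z a]
  rw [sum_congr rfl h, sum_add_distrib]
  ring

/-- The product of two sums over pairs, sorted by the number of common elements. -/
theorem sum_pairs_mul_sum_pairs [CommSemiring R] (S : Finset ι) {H K : ι → ι → R}
    (hH : ∀ x y, H x y = H y x) (hK : ∀ x y, K x y = K y x) :
    (∑ x ∈ S, ∑ y ∈ S.erase x, H x y) * (∑ x ∈ S, ∑ y ∈ S.erase x, K x y)
      = S.injSum 4 (fun f => H (f 0) (f 1) * K (f 2) (f 3))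
        + 4 * S.injSum 3 (fun f => H (f 0) (f 1) * K (f 0) (f 2))
        + 2 * S.injSum 2 (fun f => H (f 0) (f 1) * K (f 0) (f 1)) := by
  rw [injSum_four S fun x y z w => H x y * K z w, injSum_three S fun x y z => H x y * K x z,
    injSum_two S fun x y => H x y * K x y]
  -- With `(x, y)` fixed, extracting first `x` and then `y` from the second sum sorts its pairs:
  -- disjoint from `{x, y}`, meeting it only in `x`, only in `y`, or equal to it. The `y` term is
  -- written with `H y x` so that it is the mirror image of the `x` term.
  have h : ∀ x ∈ S, ∀ y ∈ S.erase x, H x y * (∑ x ∈ S, ∑ y ∈ S.erase x, K x y)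
      = ∑ z ∈ (S.erase x).erase y, ∑ w ∈ ((S.erase x).erase y).erase z, H x y * K z w
        + 2 * ∑ z ∈ (S.erase x).erase y, H x y * K x z
        + 2 * ∑ z ∈ (S.erase y).erase x, H y x * K y z
        + 2 * (H x y * K x y) := by
    intro x hx y hy
    have h1 : ∑ x ∈ S, ∑ y ∈ S.erase x, K x y
        = ∑ z ∈ (S.erase x).erase y, ∑ w ∈ ((S.erase x).erase y).erase z, K z w
          + 2 * ∑ z ∈ (S.erase x).erase y, K y z
          + 2 * (K x y + ∑ z ∈ (S.erase x).erase y, K x z) := by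
      rw [← sum_sum_erase_insert (notMem_erase y _) hK, insert_erase hy,
        ← sum_insert (f := fun z => K x z) (notMem_erase y _), insert_erase hy,
        ← sum_sum_erase_insert (notMem_erase x _) hK, insert_erase hx]
    rw [h1, erase_right_comm (a := y), hH y x]
    simp only [← mul_sum]
    ring
  rw [sum_mul]
  simp only [sum_mul]
  rw [sum_congr rfl fun x hx => sum_congr rfl (h x hx)]
  simp only [sum_add_distrib, ← mul_sum]
  -- Relabelling merges the two families with one common element, whence the coefficient 4.
  rw [← sum_sum_erase_swap S fun x y => H x y * ∑ z ∈ (S.erase x).erase y, K x z]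
  ring

end Finset

/-! ### First and second moments of pair sums -/

namespace MeasureTheory

variable {E : Type*} [MeasurableSpace E] (μ : Measure E) [SigmaFinite μ]

theorem lintegral_pi_one {f : E → ℝ≥0∞} (hf : Measurable f) :
    ∫⁻ x, f (x 0) ∂Measure.pi (fun _ : Fin 1 => μ) = ∫⁻ a, f a ∂μ := by
  rw [lintegral_pi_succ μ (by fun_prop)]
  simp

theorem lintegral_pi_two {f : E × E → ℝ≥0∞} (hf : Measurable f) :
    ∫⁻ x, f (x 0, x 1) ∂Measure.pi (fun _ : Fin 2 => μ) = ∫⁻ a, ∫⁻ b, f (a, b) ∂μ ∂μ := by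
  rw [lintegral_pi_succ μ (by fun_prop)]
  exact lintegral_congr fun a => lintegral_pi_one μ (f := fun b => f (a, b)) (by fun_prop)

theorem lintegral_pi_three {f : E × E × E → ℝ≥0∞} (hf : Measurable f) :
    ∫⁻ x, f (x 0, x 1, x 2) ∂Measure.pi (fun _ : Fin 3 => μ)
      = ∫⁻ a, ∫⁻ b, ∫⁻ c, f (a, b, c) ∂μ ∂μ ∂μ := by
  rw [lintegral_pi_succ μ (by fun_prop)]
  exact lintegral_congr fun a => lintegral_pi_two μ (f := fun p => f (a, p)) (by fun_prop)

theorem lintegral_pi_four {f : E × E × E × E → ℝ≥0∞} (hf : Measurable f) :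
    ∫⁻ x, f (x 0, x 1, x 2, x 3) ∂Measure.pi (fun _ : Fin 4 => μ)
      = ∫⁻ a, ∫⁻ b, ∫⁻ c, ∫⁻ d, f (a, b, c, d) ∂μ ∂μ ∂μ ∂μ := by
  rw [lintegral_pi_succ μ (by fun_prop)]
  exact lintegral_congr fun a => lintegral_pi_three μ (f := fun p => f (a, p)) (by fun_prop)

end MeasureTheory

namespace RandomGeometricGraph

/-- The sum of `g` over the ordered pairs of points with distinct indices. -/
noncomputable def PointProcess.pairSum {Ω E : Type*} [MeasurableSpace Ω] [MeasurableSpace E]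
    (η : PointProcess Ω E) (g : E × E → ℝ≥0∞) (ω : Ω) : ℝ≥0∞ :=
  ∑ i ∈ Finset.range (η.N ω), ∑ j ∈ (Finset.range (η.N ω)).erase i, g (η.X i ω, η.X j ω)

theorem PointProcess.measurable_pairSum {Ω E : Type*} [MeasurableSpace Ω] [MeasurableSpace E]
    (η : PointProcess Ω E) {g : E × E → ℝ≥0∞} (hg : Measurable g) :
    Measurable (η.pairSum g) :=
  η.measurable_of_N (Φ := fun n ω =>
      ∑ i ∈ Finset.range n, ∑ j ∈ (Finset.range n).erase i, g (η.X i ω, η.X j ω))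
    fun _ => Finset.measurable_sum _ fun i _ => Finset.measurable_sum _ fun j _ =>
      hg.comp ((η.measurable_X i).prodMk (η.measurable_X j))

namespace HasPoissonCounts

variable {Ω E : Type*} [MeasurableSpace Ω] [MetricSpace E] [SecondCountableTopology E]
  [MeasurableSpace E] [BorelSpace E] {P : Measure Ω} {η : PointProcess Ω E} {μ : Measure E}
  [IsFiniteMeasure μ] [NullSingletonClass μ] {g h : E × E → ℝ≥0∞}

theorem lintegral_pairSum (hη : HasPoissonCounts P η μ) (hg : Measurable g) :
    ∫⁻ ω, η.pairSum g ω ∂P = ∫⁻ x, ∫⁻ y, g (x, y) ∂μ ∂μ := by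
  rw [← lintegral_pi_two μ hg, ← hη.lintegral_injSum (by fun_prop)]
  exact lintegral_congr fun ω =>
    (Finset.injSum_two _ fun i j => g (η.X i ω, η.X j ω)).symm

/-- The mixed second moment of two second order U-statistics of a Poisson process. -/
theorem lintegral_pairSum_mul_pairSum (hη : HasPoissonCounts P η μ) (hg : Measurable g)
    (hh : Measurable h) (hgs : ∀ x y, g (x, y) = g (y, x)) (hhs : ∀ x y, h (x, y) = h (y, x)) :
    ∫⁻ ω, η.pairSum g ω * η.pairSum h ω ∂P
      = (∫⁻ x, ∫⁻ y, g (x, y) ∂μ ∂μ) * (∫⁻ x, ∫⁻ y, h (x, y) ∂μ ∂μ)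
        + 4 * ∫⁻ x, (∫⁻ y, g (x, y) ∂μ) * (∫⁻ y, h (x, y) ∂μ) ∂μ
        + 2 * ∫⁻ x, ∫⁻ y, g (x, y) * h (x, y) ∂μ ∂μ := by
  have h4 := hη.lintegral_injSum (k := 4)
    (φ := fun x => g (x 0, x 1) * h (x 2, x 3)) (by fun_prop)
  have h3 := hη.lintegral_injSum (k := 3)
    (φ := fun x => g (x 0, x 1) * h (x 0, x 2)) (by fun_prop)
  have h2 := hη.lintegral_injSum (k := 2)
    (φ := fun x => g (x 0, x 1) * h (x 0, x 1)) (by fun_prop)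
  rw [lintegral_pi_four μ (f := fun p => g (p.1, p.2.1) * h (p.2.2.1, p.2.2.2)) (by fun_prop)] at h4
  rw [lintegral_pi_three μ (f := fun p => g (p.1, p.2.1) * h (p.1, p.2.2)) (by fun_prop)] at h3
  rw [lintegral_pi_two μ (f := fun p => g p * h p) (by fun_prop)] at h2
  have hmeas : ∀ (k : ℕ) {φ : (Fin k → E) → ℝ≥0∞}, Measurable φ → Measurable fun ω =>
      (Finset.range (η.N ω)).injSum k (fun f => φ fun j => η.X (f j) ω) := by
    intro k φ hφ
    exact η.measurable_of_N (Φ := fun n ω =>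
        (Finset.range n).injSum k (fun f => φ fun j => η.X (f j) ω))
      fun n => Finset.measurable_sum _ fun f _ => hφ.comp (η.measurable_tuple f)
  have hsum : ∀ ω, η.pairSum g ω * η.pairSum h ω = _ := fun ω =>
    (Finset.range (η.N ω)).sum_pairs_mul_sum_pairs (H := fun i j => g (η.X i ω, η.X j ω))
      (K := fun i j => h (η.X i ω, η.X j ω)) (fun _ _ => hgs _ _) fun _ _ => hhs _ _
  have hm2 := hmeas 2 (φ := fun x => g (x 0, x 1) * h (x 0, x 1)) (by fun_prop)
  have hm3 := hmeas 3 (φ := fun x => g (x 0, x 1) * h (x 0, x 2)) (by fun_prop)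
  rw [lintegral_congr hsum, lintegral_add_right _ (hm2.const_mul 2),
    lintegral_add_right _ (hm3.const_mul 4), lintegral_const_mul 2 hm2,
    lintegral_const_mul 4 hm3, h4, h3, h2]
  have hin : ∀ x, Measurable fun y => g (x, y) := fun x => by fun_prop
  have hih : ∀ x, Measurable fun y => h (x, y) := fun x => by fun_prop
  congr 3
  · have h1 : ∀ a b, ∫⁻ c, ∫⁻ d, g (a, b) * h (c, d) ∂μ ∂μ
        = g (a, b) * ∫⁻ c, ∫⁻ d, h (c, d) ∂μ ∂μ := by
      intro a b
      rw [← lintegral_const_mul _ hh.lintegral_prod_right']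
      exact lintegral_congr fun c => lintegral_const_mul _ (hih c)
    simp only [h1]
    rw [← lintegral_mul_const _ hg.lintegral_prod_right']
    exact lintegral_congr fun a => lintegral_mul_const _ (hin a)
  · refine lintegral_congr fun a => ?_
    rw [← lintegral_mul_const _ (hin a)]
    exact lintegral_congr fun b => lintegral_const_mul (g (a, b)) (hih a)

end HasPoissonCounts

end RandomGeometricGraph

/-! ### Covariance and variance for admissible kernels -/

theorem ENNReal.mul_le_mul_self_add_mul_self (a b : ℝ≥0∞) : a * b ≤ a * a + b * b := by
  rcases le_total a b with h | h
  · exact (mul_le_mul_left h b).trans le_add_self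
  · exact (mul_le_mul_right h a).trans le_self_add

theorem MeasureTheory.integral_sq_sub {E : Type*} [MeasurableSpace E] {μ : Measure E}
    {f g : E → ℝ} {a b : ℝ} (hff : Integrable (fun x => f x * f x) μ)
    (hfg : Integrable (fun x => f x * g x) μ) (hgf : Integrable (fun x => g x * f x) μ)
    (hgg : Integrable (fun x => g x * g x) μ) :
    ∫ x, (a * f x - b * g x) ^ 2 ∂μ = a ^ 2 * ∫ x, f x * f x ∂μ - a * b * ∫ x, f x * g x ∂μ
      - a * b * ∫ x, g x * f x ∂μ + b ^ 2 * ∫ x, g x * g x ∂μ := by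
  have h : ∀ x, (a * f x - b * g x) ^ 2 = a ^ 2 * (f x * f x) - a * b * (f x * g x)
      - a * b * (g x * f x) + b ^ 2 * (g x * g x) := fun x => by ring
  have i1 := hff.const_mul (a ^ 2)
  have i2 := hfg.const_mul (a * b)
  have i3 := hgf.const_mul (a * b)
  simp only [h]
  have i12 : Integrable (fun x => a ^ 2 * (f x * f x) - a * b * (f x * g x)) μ := i1.sub i2
  have i123 : Integrable (fun x => a ^ 2 * (f x * f x) - a * b * (f x * g x)
      - a * b * (g x * f x)) μ := i12.sub i3
  rw [integral_add i123 (hgg.const_mul _), integral_sub i12 i3, integral_sub i1 i2]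
  simp only [integral_const_mul]

namespace RandomGeometricGraph

/-- A measurable symmetric kernel with bounded potential and finite second moment. -/
structure IsAdmissibleKernel {E : Type*} [MeasurableSpace E] (μ : Measure E)
    (g : E × E → ℝ≥0∞) : Prop where
  measurable : Measurable g
  symm : ∀ x y, g (x, y) = g (y, x)
  bounded : ∃ C : ℝ≥0, ∀ x, ∫⁻ y, g (x, y) ∂μ ≤ C
  finite_sq : ∫⁻ x, ∫⁻ y, g (x, y) * g (x, y) ∂μ ∂μ ≠ ∞

namespace IsAdmissibleKernel

variable {E : Type*} [MeasurableSpace E] {μ : Measure E} [IsFiniteMeasure μ]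
  {g h : E × E → ℝ≥0∞}

theorem lintegral_ne_top (hg : IsAdmissibleKernel μ g) : ∫⁻ x, ∫⁻ y, g (x, y) ∂μ ∂μ ≠ ∞ := by
  obtain ⟨C, hC⟩ := hg.bounded
  refine ne_top_of_le_ne_top ?_ (lintegral_mono hC)
  simp [ENNReal.mul_eq_top]

theorem lintegral_mul_ne_top (hg : IsAdmissibleKernel μ g) (hh : IsAdmissibleKernel μ h) :
    ∫⁻ x, ∫⁻ y, g (x, y) * h (x, y) ∂μ ∂μ ≠ ∞ := by
  have hgm := hg.measurable
  have hhm := hh.measurable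
  have h1 : ∫⁻ x, ∫⁻ y, g (x, y) * h (x, y) ∂μ ∂μ ≤ ∫⁻ x, ∫⁻ y, g (x, y) * g (x, y) ∂μ ∂μ
      + ∫⁻ x, ∫⁻ y, h (x, y) * h (x, y) ∂μ ∂μ := by
    rw [← lintegral_add_left (f := fun x => ∫⁻ y, g (x, y) * g (x, y) ∂μ)
      (hgm.mul hgm).lintegral_prod_right']
    refine lintegral_mono fun x => ?_
    rw [← lintegral_add_left (by fun_prop)]
    exact lintegral_mono fun y => ENNReal.mul_le_mul_self_add_mul_self _ _
  exact ne_top_of_le_ne_top (ENNReal.add_ne_top.2 ⟨hg.finite_sq, hh.finite_sq⟩) h1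

theorem lintegral_potential_mul_ne_top (hg : IsAdmissibleKernel μ g)
    (hh : IsAdmissibleKernel μ h) :
    ∫⁻ x, (∫⁻ y, g (x, y) ∂μ) * (∫⁻ y, h (x, y) ∂μ) ∂μ ≠ ∞ := by
  obtain ⟨C, hC⟩ := hg.bounded
  obtain ⟨D, hD⟩ := hh.bounded
  refine ne_top_of_le_ne_top (b := ∫⁻ _, (C : ℝ≥0∞) * D ∂μ) ?_
    (lintegral_mono fun x => mul_le_mul' (hC x) (hD x))
  rw [lintegral_const]
  exact ENNReal.mul_ne_top (ENNReal.mul_ne_top ENNReal.coe_ne_top ENNReal.coe_ne_top)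
    (measure_ne_top μ _)

theorem integrable_potential_mul (hg : IsAdmissibleKernel μ g) (hh : IsAdmissibleKernel μ h) :
    Integrable (fun x => (∫⁻ y, g (x, y) ∂μ).toReal * (∫⁻ y, h (x, y) ∂μ).toReal) μ := by
  have hgm : Measurable fun x => ∫⁻ y, g (x, y) ∂μ := hg.measurable.lintegral_prod_right'
  have hhm : Measurable fun x => ∫⁻ y, h (x, y) ∂μ := hh.measurable.lintegral_prod_right'
  have hm : Measurable fun x => (∫⁻ y, g (x, y) ∂μ) * (∫⁻ y, h (x, y) ∂μ) := hgm.mul hhm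
  simpa only [ENNReal.toReal_mul] using integrable_toReal_of_lintegral_ne_top
    hm.aemeasurable (hg.lintegral_potential_mul_ne_top hh)

theorem integral_potential_mul (hg : IsAdmissibleKernel μ g) (hh : IsAdmissibleKernel μ h) :
    ∫ x, (∫⁻ y, g (x, y) ∂μ).toReal * (∫⁻ y, h (x, y) ∂μ).toReal ∂μ
      = (∫⁻ x, (∫⁻ y, g (x, y) ∂μ) * (∫⁻ y, h (x, y) ∂μ) ∂μ).toReal := by
  have hgm : Measurable fun x => ∫⁻ y, g (x, y) ∂μ := hg.measurable.lintegral_prod_right'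
  have hhm : Measurable fun x => ∫⁻ y, h (x, y) ∂μ := hh.measurable.lintegral_prod_right'
  have hm : Measurable fun x => (∫⁻ y, g (x, y) ∂μ) * (∫⁻ y, h (x, y) ∂μ) := hgm.mul hhm
  rw [← integral_toReal hm.aemeasurable (ae_lt_top hm (hg.lintegral_potential_mul_ne_top hh))]
  simp only [ENNReal.toReal_mul]

end IsAdmissibleKernel

namespace HasPoissonCounts

variable {Ω E : Type*} [MeasurableSpace Ω] [MetricSpace E] [SecondCountableTopology E]
  [MeasurableSpace E] [BorelSpace E] {P : Measure Ω} {η : PointProcess Ω E} {μ : Measure E}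
  [IsFiniteMeasure μ] [NullSingletonClass μ] {g h : E × E → ℝ≥0∞}

theorem lintegral_pairSum_mul_pairSum_ne_top (hη : HasPoissonCounts P η μ)
    (hg : IsAdmissibleKernel μ g) (hh : IsAdmissibleKernel μ h) :
    ∫⁻ ω, η.pairSum g ω * η.pairSum h ω ∂P ≠ ∞ := by
  rw [hη.lintegral_pairSum_mul_pairSum hg.measurable hh.measurable hg.symm hh.symm]
  have h1 := ENNReal.mul_ne_top hg.lintegral_ne_top hh.lintegral_ne_top
  have h2 := ENNReal.mul_ne_top (by simp : (4 : ℝ≥0∞) ≠ ∞) (hg.lintegral_potential_mul_ne_top hh)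
  have h3 := ENNReal.mul_ne_top (by simp : (2 : ℝ≥0∞) ≠ ∞) (hg.lintegral_mul_ne_top hh)
  exact ENNReal.add_ne_top.2 ⟨ENNReal.add_ne_top.2 ⟨h1, h2⟩, h3⟩

theorem memLp_two_pairSum (hη : HasPoissonCounts P η μ) (hg : IsAdmissibleKernel μ g) :
    MemLp (fun ω => (η.pairSum g ω).toReal) 2 P := by
  have hm := η.measurable_pairSum hg.measurable
  rw [memLp_two_iff_integrable_sq hm.ennreal_toReal.aestronglyMeasurable]
  have := integrable_toReal_of_lintegral_ne_top (hm.mul hm).aemeasurable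
    (hη.lintegral_pairSum_mul_pairSum_ne_top hg hg)
  simp only [Pi.mul_apply, ENNReal.toReal_mul] at this
  simpa only [sq] using this

theorem integral_pairSum (hη : HasPoissonCounts P η μ) (hg : IsAdmissibleKernel μ g) :
    ∫ ω, (η.pairSum g ω).toReal ∂P = (∫⁻ x, ∫⁻ y, g (x, y) ∂μ ∂μ).toReal := by
  have hm := η.measurable_pairSum hg.measurable
  have h1 := hη.lintegral_pairSum hg.measurable
  rw [integral_toReal hm.aemeasurable (ae_lt_top hm (h1 ▸ hg.lintegral_ne_top)), h1]

/-- The term of the mixed moment coming from four distinct points is the product of the means and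
cancels; finiteness of every term licenses the passage to real numbers. -/
theorem covariance_pairSum [IsProbabilityMeasure P] (hη : HasPoissonCounts P η μ)
    (hg : IsAdmissibleKernel μ g) (hh : IsAdmissibleKernel μ h) :
    cov[fun ω => (η.pairSum g ω).toReal, fun ω => (η.pairSum h ω).toReal; P]
      = 4 * ∫ x, (∫⁻ y, g (x, y) ∂μ).toReal * (∫⁻ y, h (x, y) ∂μ).toReal ∂μ
        + 2 * (∫⁻ x, ∫⁻ y, g (x, y) * h (x, y) ∂μ ∂μ).toReal := by
  have hgm := η.measurable_pairSum hg.measurable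
  have hhm := η.measurable_pairSum hh.measurable
  have hfin := hη.lintegral_pairSum_mul_pairSum_ne_top hg hh
  rw [covariance_eq_sub (hη.memLp_two_pairSum hg) (hη.memLp_two_pairSum hh),
    hη.integral_pairSum hg, hη.integral_pairSum hh, hg.integral_potential_mul hh]
  have h1 : ∫ ω, ((fun ω => (η.pairSum g ω).toReal) * fun ω => (η.pairSum h ω).toReal) ω ∂P
      = (∫⁻ ω, η.pairSum g ω * η.pairSum h ω ∂P).toReal := by
    have hm : Measurable fun ω => η.pairSum g ω * η.pairSum h ω := hgm.mul hhm
    rw [← integral_toReal hm.aemeasurable (ae_lt_top hm hfin)]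
    simp only [ENNReal.toReal_mul, Pi.mul_apply]
  have h2 := ENNReal.mul_ne_top hg.lintegral_ne_top hh.lintegral_ne_top
  have h3 := ENNReal.mul_ne_top (by simp : (4 : ℝ≥0∞) ≠ ∞) (hg.lintegral_potential_mul_ne_top hh)
  have h4 := ENNReal.mul_ne_top (by simp : (2 : ℝ≥0∞) ≠ ∞) (hg.lintegral_mul_ne_top hh)
  rw [h1, hη.lintegral_pairSum_mul_pairSum hg.measurable hh.measurable hg.symm hh.symm,
    ENNReal.toReal_add (ENNReal.add_ne_top.2 ⟨h2, h3⟩) h4, ENNReal.toReal_add h2 h3]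
  simp only [ENNReal.toReal_mul, ENNReal.toReal_ofNat]
  ring

/-- By bilinearity the potential terms assemble into a perfect square. The mixed diagonal terms
enter with the factor `-a * b` and nonnegative integrals, so they can be dropped. -/
theorem variance_pairSum_sub_le [IsProbabilityMeasure P] (hη : HasPoissonCounts P η μ)
    (hg : IsAdmissibleKernel μ g) (hh : IsAdmissibleKernel μ h) {a b : ℝ} (ha : 0 ≤ a)
    (hb : 0 ≤ b) :
    Var[fun ω => a * (η.pairSum g ω).toReal - b * (η.pairSum h ω).toReal; P]
      ≤ 4 * ∫ x, (a * (∫⁻ y, g (x, y) ∂μ).toReal - b * (∫⁻ y, h (x, y) ∂μ).toReal) ^ 2 ∂μ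
        + 2 * (a ^ 2 * (∫⁻ x, ∫⁻ y, g (x, y) * g (x, y) ∂μ ∂μ).toReal
          + b ^ 2 * (∫⁻ x, ∫⁻ y, h (x, y) * h (x, y) ∂μ ∂μ).toReal) := by
  have hG := (hη.memLp_two_pairSum hg).const_mul a
  have hH := (hη.memLp_two_pairSum hh).const_mul b
  have hm := (hG.sub hH).aemeasurable
  have h1 : Var[fun ω => a * (η.pairSum g ω).toReal - b * (η.pairSum h ω).toReal; P] = _ :=
    (covariance_self hm).symm.trans (covariance_sub_sub hG hH hG hH)
  simp only [covariance_const_mul_left, covariance_const_mul_right] at h1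
  rw [h1, hη.covariance_pairSum hg hg, hη.covariance_pairSum hg hh, hη.covariance_pairSum hh hg,
    hη.covariance_pairSum hh hh]
  have h2 : ∫ x, (a * (∫⁻ y, g (x, y) ∂μ).toReal - b * (∫⁻ y, h (x, y) ∂μ).toReal) ^ 2 ∂μ
      = a ^ 2 * ∫ x, (∫⁻ y, g (x, y) ∂μ).toReal * (∫⁻ y, g (x, y) ∂μ).toReal ∂μ
        - a * b * ∫ x, (∫⁻ y, g (x, y) ∂μ).toReal * (∫⁻ y, h (x, y) ∂μ).toReal ∂μ
        - a * b * ∫ x, (∫⁻ y, h (x, y) ∂μ).toReal * (∫⁻ y, g (x, y) ∂μ).toReal ∂μ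
        + b ^ 2 * ∫ x, (∫⁻ y, h (x, y) ∂μ).toReal * (∫⁻ y, h (x, y) ∂μ).toReal ∂μ :=
    integral_sq_sub (hg.integrable_potential_mul hg) (hg.integrable_potential_mul hh)
      (hh.integrable_potential_mul hg) (hh.integrable_potential_mul hh)
  rw [h2]
  have h3 := mul_nonneg (mul_nonneg ha hb)
    (ENNReal.toReal_nonneg (a := ∫⁻ x, ∫⁻ y, g (x, y) * h (x, y) ∂μ ∂μ))
  have h4 := mul_nonneg (mul_nonneg ha hb)
    (ENNReal.toReal_nonneg (a := ∫⁻ x, ∫⁻ y, h (x, y) * g (x, y) ∂μ ∂μ))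
  linarith

end HasPoissonCounts

end RandomGeometricGraph

/-! ### Radial integrals and the boundary layer -/

section Radial

variable {E : Type*} [NormedAddCommGroup E] [NormedSpace ℝ E] [FiniteDimensional ℝ E]
  [Nontrivial E] [MeasurableSpace E] [BorelSpace E] (ν : Measure E) [ν.IsAddHaarMeasure]

/-- The integral of a power of the norm over a ball, in polar coordinates. -/
theorem MeasureTheory.lintegral_norm_rpow_closedBall {δ τ : ℝ} (hδ : 0 < δ)
    (hτ : 0 < τ + Module.finrank ℝ E) :
    ∫⁻ y, ENNReal.ofReal (if ‖y‖ ≤ δ then ‖y‖ ^ τ else 0) ∂ν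
      = ENNReal.ofReal (Module.finrank ℝ E * ν.real (ball 0 1)
        * (δ ^ (τ + Module.finrank ℝ E) / (τ + Module.finrank ℝ E))) := by
  set n := Module.finrank ℝ E with hn
  have hn1 : 1 ≤ n := Module.finrank_pos
  have hr : -1 < τ + n - 1 := by linarith
  let f : ℝ → ℝ := fun s => if s ≤ δ then s ^ τ else 0
  have hf : ∀ s ∈ Set.Ioi (0 : ℝ), s ^ (n - 1) • f s
      = (Set.Iic δ).indicator (fun s => s ^ (τ + n - 1)) s := by
    intro s hs
    have hs' : 0 < s := hs
    by_cases h : s ≤ δ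
    · rw [Set.indicator_of_mem (Set.mem_Iic.2 h)]
      simp only [f, if_pos h, smul_eq_mul]
      rw [← Real.rpow_natCast, ← Real.rpow_add hs', Nat.cast_sub hn1]
      congr 1
      push_cast
      ring
    · rw [Set.indicator_of_notMem (by simpa using h)]
      simp [f, h]
  have hIoc : Set.Iic δ ∩ Set.Ioi 0 = Set.Ioc 0 δ := by rw [Set.inter_comm, Set.Ioi_inter_Iic]
  have hint : Integrable (fun y : E => f ‖y‖) ν := by
    rw [integrable_fun_norm_addHaar, integrableOn_congr_fun hf measurableSet_Ioi,
      IntegrableOn, integrable_indicator_iff measurableSet_Iic, IntegrableOn,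
      Measure.restrict_restrict measurableSet_Iic, hIoc]
    exact (intervalIntegrable_iff_integrableOn_Ioc_of_le hδ.le).1
      (intervalIntegral.intervalIntegrable_rpow' hr)
  have hnn : ∀ y : E, 0 ≤ f ‖y‖ := fun y => by
    simp only [f]
    split_ifs <;> positivity
  rw [← ofReal_integral_eq_lintegral_ofReal hint (Eventually.of_forall hnn),
    integral_fun_norm_addHaar, setIntegral_congr_fun measurableSet_Ioi hf,
    integral_indicator measurableSet_Iic, Measure.restrict_restrict measurableSet_Iic, hIoc,
    ← intervalIntegral.integral_of_le hδ.le, integral_rpow (Or.inl hr)]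
  have h1 : τ + n - 1 + 1 = τ + n := by ring
  rw [h1, Real.zero_rpow hτ.ne', sub_zero, nsmul_eq_mul, smul_eq_mul, mul_assoc]

omit [FiniteDimensional ℝ E] [Nontrivial E] [MeasurableSpace E] [BorelSpace E] in
/-- The points of a closed set within distance `δ` of its complement lie within `δ` of its
frontier. -/
theorem IsClosed.mem_cthickening_frontier {W : Set E} (hW : IsClosed W) {x : E} (hx : x ∈ W)
    {δ : ℝ} (h : ¬ closedBall x δ ⊆ W) : x ∈ cthickening δ (frontier W) := by
  obtain ⟨y, hy, hyW⟩ := Set.not_subset.1 h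
  -- A connected segment from `W` to its complement cannot avoid the frontier, as it would be split
  -- by the open sets `interior W` and `Wᶜ`.
  have hne : (segment ℝ x y ∩ frontier W).Nonempty := by
    by_contra hne
    have hsub : segment ℝ x y ⊆ interior W ∪ Wᶜ := by
      intro z hz
      by_cases hzW : z ∈ W
      · left
        by_contra hzi
        exact hne ⟨z, hz, subset_closure hzW, hzi⟩
      · exact Or.inr hzW
    rcases (convex_segment x y).isPreconnected.subset_or_subset isOpen_interior hW.isOpen_compl
      (Set.disjoint_compl_right_iff_subset.2 interior_subset) hsub with h1 | h1
    · exact hyW (interior_subset (h1 (right_mem_segment ℝ x y)))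
    · exact h1 (left_mem_segment ℝ x y) hx
  obtain ⟨z, hz, hzf⟩ := hne
  refine mem_cthickening_of_dist_le x z δ _ hzf ?_
  rw [dist_comm]
  refine (convex_closedBall x δ).segment_subset (mem_closedBall_self ?_) hy hz
  exact dist_nonneg.trans hy

omit [Nontrivial E] in
/-- The boundary layer of a convex body of width `δ` has volume tending to zero with `δ`. -/
theorem Convex.tendsto_measure_boundary_layer {W : Set E} (hc : Convex ℝ W) (hW : IsCompact W) :
    Tendsto (fun δ => ν (W ∩ Metric.cthickening δ (frontier W))) (𝓝 0) (𝓝 0) := by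
  have hfr : IsCompact (frontier W) :=
    hW.of_isClosed_subset isClosed_frontier hW.isClosed.frontier_subset
  have h := tendsto_measure_cthickening_of_isCompact (μ := ν) hfr
  -- This is where convexity of `W` is needed: its frontier is null.
  rw [hc.addHaar_frontier ν] at h
  exact tendsto_of_tendsto_of_tendsto_of_le_of_le tendsto_const_nhds h (fun _ => bot_le)
    fun _ => measure_mono Set.inter_subset_right

end Radial

/-! ### The length kernel and its potential -/

namespace RandomGeometricGraph

/-- The kernel whose pair sum is twice the length power functional. -/
noncomputable def lengthKernel {E : Type*} [NormedAddCommGroup E] (δ τ : ℝ) (p : E × E) : ℝ≥0∞ :=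
  ENNReal.ofReal (if ‖p.1 - p.2‖ ≤ δ then ‖p.1 - p.2‖ ^ τ else 0)

/-- Squaring doubles the exponent, so finiteness of the second moment asks for `2 * τ + d > 0`; this
is the source of the condition `τ > -d/2`. -/
theorem lengthKernel_mul_self {E : Type*} [NormedAddCommGroup E] (δ τ : ℝ) (p : E × E) :
    lengthKernel δ τ p * lengthKernel δ τ p = lengthKernel δ (2 * τ) p := by
  unfold lengthKernel
  split_ifs
  · rw [← ENNReal.ofReal_mul (by positivity), mul_comm 2 τ, Real.rpow_mul (norm_nonneg _)]
    norm_cast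
    rw [sq]
  · simp

section Potential

variable {E : Type*} [NormedAddCommGroup E] [MeasurableSpace E] [BorelSpace E]

theorem measurable_lengthKernel [SecondCountableTopology E] (δ τ : ℝ) :
    Measurable (lengthKernel δ τ : E × E → ℝ≥0∞) := by
  have hn : Measurable fun p : E × E => ‖p.1 - p.2‖ := by fun_prop
  exact (Measurable.ite (measurableSet_le hn measurable_const) (hn.pow_const τ)
    measurable_const).ennreal_ofReal

omit [BorelSpace E] in
theorem lintegral_lengthKernel_restrict_eq (ν : Measure E) {W : Set E} (hW : MeasurableSet W)
    {δ : ℝ} (τ : ℝ) {x : E} (h : closedBall x δ ⊆ W) :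
    ∫⁻ y, lengthKernel δ τ (x, y) ∂ν.restrict W = ∫⁻ y, lengthKernel δ τ (x, y) ∂ν := by
  rw [← lintegral_indicator hW]
  refine lintegral_congr fun y => ?_
  by_cases hy : y ∈ W
  · rw [Set.indicator_of_mem hy]
  · have hd : ¬ ‖x - y‖ ≤ δ := fun hd => hy (h (by rwa [mem_closedBall, dist_comm, dist_eq_norm]))
    rw [Set.indicator_of_notMem hy]
    simp [lengthKernel, hd]

variable [NormedSpace ℝ E] [FiniteDimensional ℝ E] [Nontrivial E]
  (ν : Measure E) [ν.IsAddHaarMeasure]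

/-- Translation invariance reduces to the radial integral at the origin; hence the value is the same
for all `x`. -/
theorem lintegral_lengthKernel {δ τ : ℝ} (hδ : 0 < δ) (hτ : 0 < τ + Module.finrank ℝ E) (x : E) :
    ∫⁻ y, lengthKernel δ τ (x, y) ∂ν = ENNReal.ofReal (Module.finrank ℝ E * ν.real (ball 0 1)
        * (δ ^ (τ + Module.finrank ℝ E) / (τ + Module.finrank ℝ E))) := by
  rw [← lintegral_norm_rpow_closedBall ν hδ hτ]
  exact lintegral_sub_left_eq_self (fun y : E => ENNReal.ofReal (if ‖y‖ ≤ δ then ‖y‖ ^ τ else 0)) x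

theorem isAdmissibleKernel_lengthKernel {δ τ : ℝ} (hδ : 0 < δ)
    (hτ : 0 < 2 * τ + Module.finrank ℝ E) {W : Set E} (hW : IsCompact W) (c : ℝ≥0) :
    IsAdmissibleKernel (c • ν.restrict W) (lengthKernel δ τ) := by
  have hτ' : 0 < τ + Module.finrank ℝ E := by
    have : (0 : ℝ) ≤ Module.finrank ℝ E := Nat.cast_nonneg _
    linarith
  have hle : ∀ τ : ℝ, 0 < τ + Module.finrank ℝ E → ∃ C : ℝ≥0, ∀ x : E,
      ∫⁻ y, lengthKernel δ τ (x, y) ∂(c • ν.restrict W) ≤ C := by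
    intro τ hτ
    refine ⟨c * Real.toNNReal (Module.finrank ℝ E * ν.real (ball 0 1)
        * (δ ^ (τ + Module.finrank ℝ E) / (τ + Module.finrank ℝ E))), fun x => ?_⟩
    rw [lintegral_smul_measure, ENNReal.coe_mul]
    refine mul_le_mul_right ?_ _
    refine (setLIntegral_le_lintegral _ _).trans ?_
    rw [lintegral_lengthKernel ν hδ hτ]
    rfl
  refine ⟨measurable_lengthKernel δ τ, fun x y => ?_, hle τ hτ', ?_⟩
  · simp only [lengthKernel, norm_sub_rev]
  · obtain ⟨C, hC⟩ := hle (2 * τ) hτ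
    simp only [lengthKernel_mul_self]
    have : IsFiniteMeasure (ν.restrict W) := ⟨by simpa using hW.measure_lt_top⟩
    refine ne_top_of_le_ne_top ?_ (lintegral_mono hC)
    rw [lintegral_const]
    exact ENNReal.mul_ne_top ENNReal.coe_ne_top (measure_ne_top _ _)

end Potential

/-- If no point is multiple, the length power functional is half a pair sum. -/
theorem lengthPower_points_eq {Ω E : Type*} [MeasurableSpace Ω] [NormedAddCommGroup E]
    [MeasurableSpace E] (η : PointProcess Ω E) (δ τ : ℝ) {ω : Ω}
    (h : Set.InjOn (fun i => η.X i ω) (Finset.range (η.N ω))) :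
    lengthPower (η.points ω) δ τ = 1 / 2 * (η.pairSum (lengthKernel δ τ) ω).toReal := by
  classical
  have h1 : (η.pairSum (lengthKernel δ τ) ω).toReal = ∑ p ∈ (Finset.range (η.N ω)).offDiag,
      if ‖η.X p.1 ω - η.X p.2 ω‖ ≤ δ then ‖η.X p.1 ω - η.X p.2 ω‖ ^ τ else 0 := by
    rw [PointProcess.pairSum, ← Finset.sum_finset_product (Finset.range (η.N ω)).offDiag _ _
      (f := fun p : ℕ × ℕ => lengthKernel δ τ (η.X p.1 ω, η.X p.2 ω))
      (by simp only [Finset.mem_offDiag, Finset.mem_erase]; tauto),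
      ENNReal.toReal_sum]
    swap
    · exact fun p _ => ENNReal.ofReal_ne_top
    refine Finset.sum_congr rfl fun p _ => ENNReal.toReal_ofReal ?_
    split_ifs <;> positivity
  rw [h1, lengthPower]
  congr 1
  refine (Finset.sum_nbij (fun p : ℕ × ℕ => (η.X p.1 ω, η.X p.2 ω)) ?_ ?_ ?_ fun _ _ => rfl).symm
  · intro p hp
    rw [Finset.mem_offDiag] at hp ⊢
    exact ⟨Finset.mem_image_of_mem _ hp.1, Finset.mem_image_of_mem _ hp.2.1,
      fun heq => hp.2.2 (h hp.1 hp.2.1 heq)⟩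
  · rintro ⟨i, j⟩ hp ⟨k, l⟩ hq heq
    rw [Finset.mem_coe, Finset.mem_offDiag] at hp hq
    obtain ⟨h1, h2⟩ := Prod.mk.inj heq
    exact Prod.ext (h hp.1 hq.1 h1) (h hp.2.1 hq.2.1 h2)
  · rintro ⟨x, y⟩ hp
    rw [Finset.mem_coe, Finset.mem_offDiag] at hp
    obtain ⟨hx, hy, hne⟩ := hp
    obtain ⟨i, hi, rfl⟩ := Finset.mem_image.1 hx
    obtain ⟨j, hj, rfl⟩ := Finset.mem_image.1 hy
    refine ⟨(i, j), ?_, rfl⟩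
    rw [Finset.mem_coe, Finset.mem_offDiag]
    exact ⟨hi, hj, fun hij => hne (by simp only at hij; rw [hij])⟩

end RandomGeometricGraph

/-! ### Supercritical scaling of the two variance terms -/

namespace RandomGeometricGraph

section Scaling

variable {E : Type*} [NormedAddCommGroup E] [NormedSpace ℝ E] [FiniteDimensional ℝ E]
  [Nontrivial E] [MeasurableSpace E] [BorelSpace E] (ν : Measure E) [ν.IsAddHaarMeasure]

/-- The weight `a` cancels the `1 / a` of the radial integral, and the normalization cancels `δ ^
a`. The result is free of `a`, which is why different exponents become comparable. -/
theorem scaled_radial_integral {t δ a b : ℝ} (ht : 0 < t) (hδ : 0 < δ) (ha : 0 < a) :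
    a / (t ^ (3 / 2 : ℝ) * δ ^ a) * (t * (b * (δ ^ a / a))) = b * (t ^ (1 / 2 : ℝ))⁻¹ := by
  have h : t ^ (3 / 2 : ℝ) = t * t ^ (1 / 2 : ℝ) := by
    rw [← Real.rpow_one_add' ht.le (by norm_num)]
    norm_num
  have h1 : 0 < δ ^ a := Real.rpow_pos_of_pos hδ a
  have h2 : 0 < t ^ (1 / 2 : ℝ) := Real.rpow_pos_of_pos ht _
  rw [h]
  field_simp

theorem scaled_potential_le {t δ τ : ℝ} (ht : 0 < t) (hδ : 0 < δ)
    (hτ : 0 < τ + Module.finrank ℝ E) (W : Set E) (x : E) :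
    (τ + Module.finrank ℝ E) / (t ^ (3 / 2 : ℝ) * δ ^ (τ + Module.finrank ℝ E))
      * (∫⁻ y, lengthKernel δ τ (x, y) ∂(t.toNNReal • ν.restrict W)).toReal
      ≤ Module.finrank ℝ E * ν.real (ball 0 1) * (t ^ (1 / 2 : ℝ))⁻¹ := by
  rw [← scaled_radial_integral ht hδ hτ]
  refine mul_le_mul_of_nonneg_left ?_ (by positivity)
  rw [lintegral_smul_measure, ENNReal.smul_def, smul_eq_mul, ENNReal.toReal_mul,
    ENNReal.coe_toReal, Real.coe_toNNReal _ ht.le]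
  refine mul_le_mul_of_nonneg_left ?_ ht.le
  refine ENNReal.toReal_le_of_le_ofReal (by positivity) ?_
  rw [← lintegral_lengthKernel ν hδ hτ x]
  exact setLIntegral_le_lintegral _ _

theorem scaled_potential_eq {t δ τ : ℝ} (ht : 0 < t) (hδ : 0 < δ)
    (hτ : 0 < τ + Module.finrank ℝ E) {W : Set E} (hW : MeasurableSet W) {x : E}
    (hx : closedBall x δ ⊆ W) :
    (τ + Module.finrank ℝ E) / (t ^ (3 / 2 : ℝ) * δ ^ (τ + Module.finrank ℝ E))
      * (∫⁻ y, lengthKernel δ τ (x, y) ∂(t.toNNReal • ν.restrict W)).toReal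
      = Module.finrank ℝ E * ν.real (ball 0 1) * (t ^ (1 / 2 : ℝ))⁻¹ := by
  rw [← scaled_radial_integral ht hδ hτ, lintegral_smul_measure, ENNReal.smul_def, smul_eq_mul,
    ENNReal.toReal_mul, ENNReal.coe_toReal, Real.coe_toNNReal _ ht.le,
    lintegral_lengthKernel_restrict_eq ν hW τ hx, lintegral_lengthKernel ν hδ hτ x,
    ENNReal.toReal_ofReal (by positivity)]

/-- The double integral is of order `t ^ 2 * δ ^ (2 * τ + n)`, against a squared normalization `t ^
3 * δ ^ (2 * τ + 2 * n)`. -/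
theorem scaled_second_moment_le {t δ τ : ℝ} (ht : 0 < t) (hδ : 0 < δ)
    (hτ : 0 < 2 * τ + Module.finrank ℝ E) {W : Set E} (hW : IsCompact W) :
    ((τ + Module.finrank ℝ E) / (t ^ (3 / 2 : ℝ) * δ ^ (τ + Module.finrank ℝ E))) ^ 2
      * (∫⁻ x, ∫⁻ y, lengthKernel δ τ (x, y) * lengthKernel δ τ (x, y)
          ∂(t.toNNReal • ν.restrict W) ∂(t.toNNReal • ν.restrict W)).toReal
      ≤ (τ + Module.finrank ℝ E) ^ 2 / (2 * τ + Module.finrank ℝ E)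
        * (Module.finrank ℝ E * ν.real (ball 0 1)) * ν.real W
        * (t * δ ^ Module.finrank ℝ E)⁻¹ := by
  set n := Module.finrank ℝ E
  set b := n * ν.real (ball (0 : E) 1) with hb
  have hb0 : 0 ≤ b := by positivity
  have h1 : (∫⁻ x, ∫⁻ y, lengthKernel δ τ (x, y) * lengthKernel δ τ (x, y)
      ∂(t.toNNReal • ν.restrict W) ∂(t.toNNReal • ν.restrict W)).toReal
      ≤ t * (b * (δ ^ (2 * τ + n) / (2 * τ + n))) * (t * ν.real W) := by
    refine ENNReal.toReal_le_of_le_ofReal (by positivity) ?_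
    calc _ ≤ ∫⁻ _ : E, ENNReal.ofReal (t * (b * (δ ^ (2 * τ + n) / (2 * τ + n))))
          ∂(t.toNNReal • ν.restrict W) := by
          refine lintegral_mono fun x => ?_
          simp only [lengthKernel_mul_self]
          rw [lintegral_smul_measure, ENNReal.ofReal_mul ht.le]
          refine mul_le_mul_right ?_ _
          rw [hb, ← lintegral_lengthKernel ν hδ hτ x]
          exact setLIntegral_le_lintegral _ _
      _ = _ := by
          rw [lintegral_const, ENNReal.ofReal_mul (q := t * ν.real W) (by positivity),
            ENNReal.ofReal_mul (q := ν.real W) ht.le, ofReal_measureReal hW.measure_lt_top.ne,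
            Measure.smul_apply, Measure.restrict_apply_univ]
          rfl
  refine (mul_le_mul_of_nonneg_left h1 (sq_nonneg _)).trans_eq ?_
  have h2 : (t ^ (3 / 2 : ℝ)) ^ 2 = t ^ 3 := by
    rw [← Real.rpow_natCast, ← Real.rpow_mul ht.le, ← Real.rpow_natCast]
    norm_num
  have h3 : (δ ^ (τ + n)) ^ 2 = δ ^ (2 * τ + n) * δ ^ n := by
    rw [← Real.rpow_natCast, ← Real.rpow_mul hδ.le, ← Real.rpow_natCast, ← Real.rpow_add hδ]
    congr 1
    push_cast
    ring
  have h4 : 0 < δ ^ (2 * τ + n) := Real.rpow_pos_of_pos hδ _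
  rw [div_pow, mul_pow, h2, h3]
  field_simp

/-- Away from the boundary layer the scaled potentials agree. On it both lie between `0` and `b * t
^ (-1/2)`, so their squared difference is at most `b ^ 2 / t`, and the intensity `t` cancels the
denominator. -/
theorem integral_sq_sub_scaled_potential_le {t δ τ₁ τ₂ : ℝ} (ht : 0 < t) (hδ : 0 < δ)
    (hτ₁ : 0 < τ₁ + Module.finrank ℝ E) (hτ₂ : 0 < τ₂ + Module.finrank ℝ E) {W : Set E}
    (hW : IsCompact W) :
    ∫ x, ((τ₁ + Module.finrank ℝ E) / (t ^ (3 / 2 : ℝ) * δ ^ (τ₁ + Module.finrank ℝ E))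
          * (∫⁻ y, lengthKernel δ τ₁ (x, y) ∂(t.toNNReal • ν.restrict W)).toReal
        - (τ₂ + Module.finrank ℝ E) / (t ^ (3 / 2 : ℝ) * δ ^ (τ₂ + Module.finrank ℝ E))
          * (∫⁻ y, lengthKernel δ τ₂ (x, y) ∂(t.toNNReal • ν.restrict W)).toReal) ^ 2
        ∂(t.toNNReal • ν.restrict W)
      ≤ (Module.finrank ℝ E * ν.real (ball 0 1)) ^ 2
        * ν.real (W ∩ cthickening δ (frontier W)) := by
  set n := Module.finrank ℝ E
  set b := n * ν.real (ball (0 : E) 1) with hb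
  have : IsFiniteMeasure (ν.restrict W) := ⟨by simpa using hW.measure_lt_top⟩
  have hS : MeasurableSet (cthickening δ (frontier W)) := isClosed_cthickening.measurableSet
  have h : ∫ x, (cthickening δ (frontier W)).indicator (fun _ => (b * (t ^ (1 / 2 : ℝ))⁻¹) ^ 2) x
      ∂(t.toNNReal • ν.restrict W) = b ^ 2 * ν.real (W ∩ cthickening δ (frontier W)) := by
    rw [integral_indicator_const _ hS, smul_eq_mul, measureReal_nnreal_smul_apply,
      measureReal_restrict_apply hS, Set.inter_comm, Real.coe_toNNReal _ ht.le]
    have h2 : (t ^ (1 / 2 : ℝ)) ^ 2 = t := by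
      rw [← Real.rpow_natCast, ← Real.rpow_mul ht.le]
      norm_num
    rw [mul_pow, inv_pow, h2]
    field_simp
  rw [← h]
  refine integral_mono_of_nonneg (Eventually.of_forall fun x => sq_nonneg _)
    ((integrable_const _).indicator hS) ?_
  refine Measure.ae_smul_measure ?_ _
  filter_upwards [ae_restrict_mem hW.measurableSet] with x hx
  by_cases hball : closedBall x δ ⊆ W
  · rw [scaled_potential_eq ν ht hδ hτ₁ hW.measurableSet hball,
      scaled_potential_eq ν ht hδ hτ₂ hW.measurableSet hball, sub_self, zero_pow two_ne_zero]
    exact Set.indicator_nonneg (fun _ _ => sq_nonneg _) _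
  · rw [Set.indicator_of_mem (hW.isClosed.mem_cthickening_frontier hx hball)]
    have h1 := scaled_potential_le ν ht hδ hτ₁ W x
    have h2 := scaled_potential_le ν ht hδ hτ₂ W x
    refine sq_le_sq' ?_ ?_
    · refine neg_le_sub_iff_le_add.2 (h2.trans (le_add_of_nonneg_left ?_))
      positivity
    · refine sub_le_iff_le_add.2 (h1.trans (le_add_of_nonneg_right ?_))
      positivity

end Scaling

/-! ### Convergence in probability -/

section Poisson

variable {Ω : Type*} [MeasurableSpace Ω] {P : Measure Ω} {d : ℕ}
  {W : Set (EuclideanSpace ℝ (Fin d))} {t : ℝ} {η : PointProcess Ω (EuclideanSpace ℝ (Fin d))}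

theorem IsPoissonProcess.hasPoissonCounts (h : IsPoissonProcess P W t η) :
    HasPoissonCounts P η (t.toNNReal • volume.restrict W) := by
  refine ⟨fun A hA => ?_, h.indep⟩
  rw [h.map_count A hA, Measure.smul_apply, Measure.restrict_apply hA]
  rfl

/-- Positive dimension is essential: in dimension zero the volume is a point mass. -/
instance nullSingletonClass_smul_restrict [Nonempty (Fin d)] (c : ℝ≥0) :
    NullSingletonClass (c • volume.restrict W) :=
  ⟨fun x => by simp [Measure.smul_apply]⟩

theorem isFiniteMeasure_restrict (hW : IsCompact W) : IsFiniteMeasure (volume.restrict W) :=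
  ⟨by simpa using hW.measure_lt_top⟩

theorem L_ae_eq [Nonempty (Fin d)] (hW : IsCompact W) (h : IsPoissonProcess P W t η)
    (δ τ : ℝ) :
    L η δ τ =ᵐ[P] fun ω => 1 / 2 * (η.pairSum (lengthKernel δ τ) ω).toReal := by
  have := isFiniteMeasure_restrict hW
  filter_upwards [h.hasPoissonCounts.ae_injOn] with ω hω
  exact lengthPower_points_eq η δ τ hω

theorem integrable_L [Nonempty (Fin d)] [IsProbabilityMeasure P] (hW : IsCompact W)
    (h : IsPoissonProcess P W t η) {δ τ : ℝ} (hδ : 0 < δ) (hτ : 0 < 2 * τ + d) :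
    Integrable (L η δ τ) P := by
  have := isFiniteMeasure_restrict hW
  have hk := isAdmissibleKernel_lengthKernel (volume : Measure (EuclideanSpace ℝ (Fin d))) hδ
    (by simpa using hτ) hW t.toNNReal
  refine Integrable.congr ?_ (L_ae_eq hW h δ τ).symm
  exact ((h.hasPoissonCounts.memLp_two_pairSum hk).integrable (by norm_num)).const_mul _

/-- The second entry is the first times `(t * δ ^ d) ^ (1/2)`. -/
theorem max_eq_of_one_le (ht : 0 < t) {δ : ℝ} (hδ : 0 < δ) (h : 1 ≤ t * δ ^ d) (τ : ℝ) :
    max (t * δ ^ (τ + (d : ℝ) / 2)) (t ^ (3 / 2 : ℝ) * δ ^ (τ + (d : ℝ)))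
      = t ^ (3 / 2 : ℝ) * δ ^ (τ + (d : ℝ)) := by
  refine max_eq_right ?_
  have h1 : t ^ (3 / 2 : ℝ) * δ ^ (τ + (d : ℝ))
      = t * δ ^ (τ + (d : ℝ) / 2) * (t * δ ^ d) ^ (1 / 2 : ℝ) := by
    rw [Real.mul_rpow ht.le (by positivity), ← Real.rpow_natCast, ← Real.rpow_mul hδ.le,
      mul_mul_mul_comm, ← Real.rpow_add hδ, ← Real.rpow_one_add' ht.le (by norm_num)]
    congr 2
    · norm_num
    · ring
  rw [h1]
  exact le_mul_of_one_le_right (by positivity) (Real.one_le_rpow h (by norm_num))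

/-- The bound on the variance, up to a factor, of the difference of two normalized length power
functionals. -/
noncomputable def varianceBound (W : Set (EuclideanSpace ℝ (Fin d))) (τ₁ τ₂ t δ : ℝ) : ℝ :=
  4 * ((d * volume.real (ball (0 : EuclideanSpace ℝ (Fin d)) 1)) ^ 2
    * volume.real (W ∩ cthickening δ (frontier W)))
  + 2 * ((τ₁ + d) ^ 2 / (2 * τ₁ + d) * (d * volume.real (ball (0 : EuclideanSpace ℝ (Fin d)) 1))
      * volume.real W * (t * δ ^ d)⁻¹
    + (τ₂ + d) ^ 2 / (2 * τ₂ + d) * (d * volume.real (ball (0 : EuclideanSpace ℝ (Fin d)) 1))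
      * volume.real W * (t * δ ^ d)⁻¹)

/-- Chebyshev's inequality for the difference `Z` of scaled pair sums. Each length functional is
half a pair sum, so the threshold `ε` becomes `2 * ε`. -/
theorem measure_normL_sub_le [Nonempty (Fin d)] [IsProbabilityMeasure P] (hW : IsCompact W)
    (h : IsPoissonProcess P W t η) (ht : 0 < t) {δ τ₁ τ₂ : ℝ} (hδ : 0 < δ)
    (hτ₁ : 0 < 2 * τ₁ + d) (hτ₂ : 0 < 2 * τ₂ + d) (hsuper : 1 ≤ t * δ ^ d) {ε : ℝ} (hε : 0 < ε) :
    P {ω | ε ≤ dist ((τ₁ + d) * normL P t η δ τ₁ ω - (τ₂ + d) * normL P t η δ τ₂ ω) 0}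
      ≤ ENNReal.ofReal (varianceBound W τ₁ τ₂ t δ / (2 * ε) ^ 2) := by
  have := isFiniteMeasure_restrict hW
  have hd : (0 : ℝ) ≤ d := Nat.cast_nonneg d
  have ha₁ : 0 < τ₁ + d := by linarith
  have ha₂ : 0 < τ₂ + d := by linarith
  have hη := h.hasPoissonCounts
  have hk : ∀ τ : ℝ, 0 < 2 * τ + d → IsAdmissibleKernel
      (t.toNNReal • (volume : Measure (EuclideanSpace ℝ (Fin d))).restrict W)
      (lengthKernel δ τ) := fun τ hτ =>
    isAdmissibleKernel_lengthKernel volume hδ (by simpa using hτ) hW t.toNNReal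
  set Y : ℝ → Ω → ℝ := fun τ ω => (η.pairSum (lengthKernel δ τ) ω).toReal with hY
  set c : ℝ → ℝ := fun τ => (τ + d) / (t ^ (3 / 2 : ℝ) * δ ^ (τ + (d : ℝ))) with hc
  have hYm : ∀ τ : ℝ, 0 < 2 * τ + d → MemLp (Y τ) 2 P := fun τ hτ =>
    hη.memLp_two_pairSum (hk τ hτ)
  set Z : Ω → ℝ := fun ω => c τ₁ * Y τ₁ ω - c τ₂ * Y τ₂ ω with hZ
  have hZm : MemLp Z 2 P := ((hYm τ₁ hτ₁).const_mul _).sub ((hYm τ₂ hτ₂).const_mul _)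
  have hEZ : ∫ ω, Z ω ∂P = c τ₁ * ∫ ω, Y τ₁ ω ∂P - c τ₂ * ∫ ω, Y τ₂ ω ∂P := by
    rw [hZ, integral_sub, integral_const_mul, integral_const_mul]
    · exact ((hYm τ₁ hτ₁).integrable (by norm_num)).const_mul _
    · exact ((hYm τ₂ hτ₂).integrable (by norm_num)).const_mul _
  have hnorm : ∀ τ, (fun ω => (τ + d) * normL P t η δ τ ω)
      =ᵐ[P] fun ω => 1 / 2 * (c τ * Y τ ω - c τ * ∫ ω, Y τ ω ∂P) := by
    intro τ
    have hL := L_ae_eq hW h δ τ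
    filter_upwards [hL] with ω hω
    rw [normL, hω, integral_congr_ae hL, integral_const_mul, max_eq_of_one_le ht hδ hsuper]
    simp only [hc, hY]
    ring
  have hvar : Var[Z; P] ≤ varianceBound W τ₁ τ₂ t δ := by
    have hc₁ : 0 ≤ c τ₁ := by positivity
    have hc₂ : 0 ≤ c τ₂ := by positivity
    refine (hη.variance_pairSum_sub_le (hk τ₁ hτ₁) (hk τ₂ hτ₂) hc₁ hc₂).trans ?_
    have h1 := integral_sq_sub_scaled_potential_le
      (volume : Measure (EuclideanSpace ℝ (Fin d))) ht hδ (τ₁ := τ₁) (τ₂ := τ₂)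
      (by simpa using ha₁) (by simpa using ha₂) hW
    have h2 := scaled_second_moment_le
      (volume : Measure (EuclideanSpace ℝ (Fin d))) ht hδ (τ := τ₁) (by simpa using hτ₁) hW
    have h3 := scaled_second_moment_le
      (volume : Measure (EuclideanSpace ℝ (Fin d))) ht hδ (τ := τ₂) (by simpa using hτ₂) hW
    simp only [finrank_euclideanSpace_fin] at h1 h2 h3
    unfold varianceBound
    gcongr
  have hsub : P {ω | ε ≤ dist ((τ₁ + d) * normL P t η δ τ₁ ω - (τ₂ + d) * normL P t η δ τ₂ ω) 0}
      ≤ P {ω | 2 * ε ≤ |Z ω - ∫ ω, Z ω ∂P|} := by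
    refine measure_mono_ae ?_
    filter_upwards [hnorm τ₁, hnorm τ₂] with ω h1 h2 hω
    have hω' : ε ≤ dist ((τ₁ + d) * normL P t η δ τ₁ ω - (τ₂ + d) * normL P t η δ τ₂ ω) 0 := hω
    rw [dist_zero_right, Real.norm_eq_abs, h1, h2, ← mul_sub, abs_mul,
      abs_of_pos (by norm_num : (0 : ℝ) < 1 / 2)] at hω'
    change 2 * ε ≤ |Z ω - ∫ ω, Z ω ∂P|
    rw [hEZ]
    have : Z ω - (c τ₁ * ∫ ω, Y τ₁ ω ∂P - c τ₂ * ∫ ω, Y τ₂ ω ∂P)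
        = c τ₁ * Y τ₁ ω - c τ₁ * ∫ ω, Y τ₁ ω ∂P
          - (c τ₂ * Y τ₂ ω - c τ₂ * ∫ ω, Y τ₂ ω ∂P) := by
      simp only [hZ]
      ring
    rw [this]
    linarith
  refine hsub.trans ((meas_ge_le_variance_div_sq hZm (by positivity)).trans ?_)
  exact ENNReal.ofReal_le_ofReal (by gcongr)

theorem tendsto_varianceBound (hWc : Convex ℝ W) (hW : IsCompact W) (τ₁ τ₂ : ℝ) {δ : ℝ → ℝ}
    (hδ : Tendsto δ atTop (𝓝 0)) (hsuper : Tendsto (fun t => t * δ t ^ d) atTop atTop) :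
    Tendsto (fun t => varianceBound W τ₁ τ₂ t (δ t)) atTop (𝓝 0) := by
  have h1 : Tendsto (fun t => volume.real (W ∩ cthickening (δ t) (frontier W))) atTop (𝓝 0) := by
    have := (ENNReal.tendsto_toReal ENNReal.zero_ne_top).comp
      ((hWc.tendsto_measure_boundary_layer volume hW).comp hδ)
    rw [ENNReal.toReal_zero] at this
    exact this
  have h2 := tendsto_inv_atTop_zero.comp hsuper
  have h3 := ((h1.const_mul ((d * volume.real (ball (0 : EuclideanSpace ℝ (Fin d)) 1)) ^ 2)).const_mul
    4).add (((h2.const_mul ((τ₁ + d) ^ 2 / (2 * τ₁ + d)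
      * (d * volume.real (ball (0 : EuclideanSpace ℝ (Fin d)) 1)) * volume.real W)).add
    (h2.const_mul ((τ₂ + d) ^ 2 / (2 * τ₂ + d)
      * (d * volume.real (ball (0 : EuclideanSpace ℝ (Fin d)) 1)) * volume.real W))).const_mul 2)
  simp only [mul_zero, add_zero] at h3
  exact h3

/-- The bound at each `t` involves the law of `η t` only, so the coupling between different `t` is
irrelevant. -/
theorem tendstoInMeasure_normL_sub [Nonempty (Fin d)] [IsProbabilityMeasure P]
    (hWc : Convex ℝ W) (hW : IsCompact W)
    {η : ℝ → PointProcess Ω (EuclideanSpace ℝ (Fin d))}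
    (hη : ∀ t, 0 < t → IsPoissonProcess P W t (η t)) {δ : ℝ → ℝ} (hδpos : ∀ t, 0 < t → 0 < δ t)
    (hδ : Tendsto δ atTop (𝓝 0)) (hsuper : Tendsto (fun t => t * δ t ^ d) atTop atTop)
    {τ₁ τ₂ : ℝ} (hτ₁ : 0 < 2 * τ₁ + d) (hτ₂ : 0 < 2 * τ₂ + d) :
    TendstoInMeasure P (fun t ω => (τ₁ + d) * normL P t (η t) (δ t) τ₁ ω
      - (τ₂ + d) * normL P t (η t) (δ t) τ₂ ω) atTop (fun _ => 0) := by
  rw [tendstoInMeasure_iff_dist]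
  intro ε hε
  have hlim : Tendsto (fun t => ENNReal.ofReal (varianceBound W τ₁ τ₂ t (δ t) / (2 * ε) ^ 2))
      atTop (𝓝 0) := by
    have := ENNReal.tendsto_ofReal
      ((tendsto_varianceBound hWc hW τ₁ τ₂ hδ hsuper).div_const ((2 * ε) ^ 2))
    simpa using this
  refine tendsto_of_tendsto_of_tendsto_of_le_of_le' tendsto_const_nhds hlim
    (Eventually.of_forall fun _ => bot_le) ?_
  filter_upwards [eventually_gt_atTop 0, hsuper.eventually_ge_atTop 1] with t ht h1
  exact measure_normL_sub_le hW (hη t ht) ht (hδpos t ht) hτ₁ hτ₂ h1 hε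

end Poisson

end RandomGeometricGraph

open RandomGeometricGraph in
theorem theorem9p1 {Ω : Type*} [MeasurableSpace Ω] (P : Measure Ω) [IsProbabilityMeasure P]
    (d : ℕ) (hd : 1 ≤ d)
    (W : Set (EuclideanSpace ℝ (Fin d))) (hWconv : Convex ℝ W) (hWcomp : IsCompact W)
    (η : ℝ → PointProcess Ω (EuclideanSpace ℝ (Fin d)))
    (hη : ∀ t, 0 < t → IsPoissonProcess P W t (η t))
    (δ : ℝ → ℝ) (hδpos : ∀ t, 0 < t → 0 < δ t) (hδ : Tendsto δ atTop (𝓝 0))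
    (hsuper : Tendsto (fun t => t * δ t ^ d) atTop atTop) :
    (∀ τ : ℝ, -(d : ℝ) / 2 < τ → ∀ t, 0 < t → Integrable (L (η t) (δ t) τ) P) ∧
    (∀ τ₁ τ₂ : ℝ, -(d : ℝ) / 2 < τ₁ → -(d : ℝ) / 2 < τ₂ →
      TendstoInMeasure P
        (fun t ω => (τ₁ + d) * normL P t (η t) (δ t) τ₁ ω - (τ₂ + d) * normL P t (η t) (δ t) τ₂ ω)
        atTop (fun _ => 0)) ∧
    (∀ τ : ℝ, -(d : ℝ) / 2 < τ →
      TendstoInMeasure P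
        (fun t ω => normL P t (η t) (δ t) τ ω - d / (τ + d) * normL P t (η t) (δ t) 0 ω)
        atTop (fun _ => 0)) := by
  have : Nonempty (Fin d) := ⟨⟨0, hd⟩⟩
  have hd0 : (0 : ℝ) < d := by exact_mod_cast hd
  have hτ : ∀ τ : ℝ, -(d : ℝ) / 2 < τ → 0 < 2 * τ + d := fun τ h => by linarith
  refine ⟨fun τ h t ht => integrable_L hWcomp (hη t ht) (hδpos t ht) (hτ τ h),
    fun τ₁ τ₂ h₁ h₂ => tendstoInMeasure_normL_sub hWconv hWcomp hη hδpos hδ hsuper (hτ τ₁ h₁)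
      (hτ τ₂ h₂), fun τ h => ?_⟩
  have ha : 0 < τ + d := by linarith
  have h0 := tendstoInMeasure_normL_sub hWconv hWcomp hη hδpos hδ hsuper (hτ τ h)
    (hτ 0 (by linarith))
  rw [tendstoInMeasure_iff_dist] at h0 ⊢
  intro ε hε
  -- The second claim with `τ₂ = 0`, divided by `τ + d`: rescaling the threshold makes the events
  -- identical.
  refine (h0 ((τ + d) * ε) (by positivity)).congr fun t => congrArg P ?_
  ext ω
  have e : (τ + d) * normL P t (η t) (δ t) τ ω - (0 + d) * normL P t (η t) (δ t) 0 ω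
      = (τ + d) * (normL P t (η t) (δ t) τ ω - d / (τ + d) * normL P t (η t) (δ t) 0 ω) := by
    field_simp
    ring
  simp only [Set.mem_ofPred_eq, dist_zero_right, e, Real.norm_eq_abs, abs_mul, abs_of_pos ha]
  exact mul_le_mul_iff_right₀ ha
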